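/- Let $n \ge 0$, let $B \subset \mathbb{C}^n$ be the open unit ball and let $\varphi : B \to \mathbb{R}$ be a smooth function such that $\omega = i\partial\bar\partial\varphi$ is a Kähler metric on $B$, i.e. the Hermitian matrix $g_{i\bar\jmath} = \partial_i\partial_{\bar\jmath}\varphi$ is positive definite at every point of $B$. Let $$R_{i\bar\jmath k\bar\ell} = -\partial_k\partial_{\bar\ell}\, g_{i\bar\jmath} + g^{p\bar q}\,(\partial_{\bar\ell}\, g_{p\bar\jmath})(\partial_k\, g_{i\bar q})$$ be its Riemann curvature tensor, where $(g^{p\bar q})$ is the inverse transpose of $(g_{p\bar q})$. The metric has constant holomorphic sectional curvature $\kappa$ if the sectional curvature of every complex line in $TB$ is $\kappa$, i.e. if $$\frac{R_{i\bar\jmath k\bar\ell}\,v^i\bar v^j v^k\bar v^\ell}{(g_{i\bar\jmath}\,v^i\bar v^j)^2} = \kappa$$ at every point of $B$ and for every $0 \ne v \in \mathbb{C}^n$. (i) If $\omega$ has constant holomorphic sectional curvature $2$ on $B$, then every point $p \in B$ has an open neighbourhood $U \subset B$ with holomorphic coordinates $z = (z^1, \ldots, z^n)$ on $U$ (that is,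 $z$ is a biholomorphic map from $U$ onto an open subset of $\mathbb{C}^n$) such that $\omega = i\partial\bar\partial\log(1+|z|^2)$ on $U$. (ii) If $\omega$ has constant holomorphic sectional curvature $-2$ on $B$, then every point $p \in B$ has an open neighbourhood $U \subset B$ with holomorphic coordinates $z = (z^1, \ldots, z^n)$ on $U$ such that $|z| < 1$ and $\omega = -i\partial\bar\partial\log(1-|z|^2)$ on $U$. -/

import Mathlib

open scoped ContDiff ComplexConjugate ComplexOrder

noncomputable section

namespace KahlerBall

/-- Complex Euclidean space `ℂⁿ` with the Hermitian norm `‖z‖² = ∑ |zⁱ|²`. -/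
abbrev Cn (n : ℕ) : Type := EuclideanSpace ℂ (Fin n)

variable {n : ℕ}

/-- The Wirtinger derivative `∂ᵢ f = ∂f/∂zⁱ = (∂f/∂xⁱ - √-1 ∂f/∂yⁱ) / 2`. -/
def dz (i : Fin n) (f : Cn n → ℂ) (z : Cn n) : ℂ :=
  (fderiv ℝ f z (EuclideanSpace.single i 1)
    - Complex.I * fderiv ℝ f z (EuclideanSpace.single i Complex.I)) / 2

/-- The Wirtinger derivative `∂f/∂z̄ⁱ = (∂f/∂xⁱ + √-1 ∂f/∂yⁱ) / 2`. -/
def dzbar (i : Fin n) (f : Cn n → ℂ) (z : Cn n) : ℂ :=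
  (fderiv ℝ f z (EuclideanSpace.single i 1)
    + Complex.I * fderiv ℝ f z (EuclideanSpace.single i Complex.I)) / 2

/-- The matrix of complex second derivatives `g_{i j̄} = ∂ᵢ ∂_{j̄} φ` of a real function `φ`. -/
def metric (φ : Cn n → ℝ) (z : Cn n) : Matrix (Fin n) (Fin n) ℂ :=
  Matrix.of fun i j => dz i (dzbar j fun w => (φ w : ℂ)) z

/-- The value of the form `√-1 ∂∂̄φ = √-1 ∑ g_{i j̄} dzⁱ ∧ dz̄ʲ` on the tangent vectors `u, v`. -/
def iddbar (φ : Cn n → ℝ) (z u v : Cn n) : ℂ :=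
  Complex.I * ∑ i, ∑ j, metric φ z i j * (u i * conj (v j) - v i * conj (u j))

/-- `φ` is a smooth real function on the open set `U` and `√-1 ∂∂̄φ` is a Kähler metric on `U`
(it is closed and of type `(1,1)` by construction; positivity is what is required). -/
structure IsKahlerPotentialOn (φ : Cn n → ℝ) (U : Set (Cn n)) : Prop where
  smooth : ContDiffOn ℝ ∞ φ U
  posDef : ∀ z ∈ U, (metric φ z).PosDef

/-- The Riemann curvature tensor of the metric `g_{i j̄} = ∂ᵢ ∂_{j̄} φ`,
`R_{i j̄ k l̄} = - ∂ₖ ∂_{l̄} g_{i j̄} + ∑ g^{p q̄} (∂_{l̄} g_{p j̄}) (∂ₖ g_{i q̄})`,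
where `(g^{p q̄})` is the inverse transpose of `(g_{p q̄})`. -/
def riemann (φ : Cn n → ℝ) (z : Cn n) (i j k l : Fin n) : ℂ :=
  - dz k (dzbar l fun w => metric φ w i j) z
    + ∑ p, ∑ q, ((metric φ z)⁻¹.transpose p q)
        * dzbar l (fun w => metric φ w p j) z * dz k (fun w => metric φ w i q) z

/-- The sectional curvature at `z` of the complex line spanned by `v ≠ 0`, that is
`R(v, v̄, v, v̄) / g(v, v̄)²`. With the real vector `X = 2 Re (∑ vⁱ ∂ᵢ)` one has
`|X|² = 2 g(v, v̄)` and `R(X, JX, JX, X) = 4 R(v, v̄, v, v̄)`, so this is the Riemannian sectional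
curvature of the real plane spanned by `X` and `JX`. -/
def holSectionalCurvature (φ : Cn n → ℝ) (z v : Cn n) : ℂ :=
  (∑ i, ∑ j, ∑ k, ∑ l, riemann φ z i j k l * v i * conj (v j) * v k * conj (v l))
    / (∑ i, ∑ j, metric φ z i j * v i * conj (v j)) ^ 2

/-- The metric `√-1 ∂∂̄φ` has constant holomorphic sectional curvature `κ` on `U`: the sectional
curvature of every complex line in every tangent space is `κ`. -/
def HasConstHolSectionalCurvatureOn (φ : Cn n → ℝ) (κ : ℝ) (U : Set (Cn n)) : Prop :=
  ∀ z ∈ U, ∀ v : Cn n, v ≠ 0 → holSectionalCurvature φ z v = (κ : ℂ)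

/-- Holomorphic coordinates `f = (f¹, …, fⁿ)` on an open subset `f.source` of `ℂⁿ`: a biholomorphic
map from `f.source` onto the open set `f.target`. -/
def IsHolomorphicCoordinates (f : OpenPartialHomeomorph (Cn n) (Cn n)) : Prop :=
  DifferentiableOn ℂ f f.source ∧ DifferentiableOn ℂ f.symm f.target

end KahlerBall

end

/-! Put `κ = 2c` with `c = ±1`. A function `h` is regarded as a section of the trivial line bundle
with Hermitian weight `e^{-cφ}`, and one asks for holomorphic `h` whose second covariant derivative
vanishes. With `αᵢ = ∂ᵢh - cφᵢh` this becomes a closed linear first order system for `(h, α)` that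
prescribes all Wirtinger derivatives (`tractor`). In the model potential `log (1 + |z|²)` its
solutions `h` are the functions spanned by `1, z¹, …, zⁿ`, so the solutions should recover the
coordinates up to a common factor.

Polarization shows that constant holomorphic sectional curvature forces `R_{i j̄ k l̄} = c (g_{i j̄}
g_{k l̄} + g_{i l̄} g_{k j̄})` (`riemann_of_const`), and this is what makes the system integrable
(`tractor_flat`). A Frobenius theorem for linear systems (`exists_hasFDerivAt_eq_of_flat`,
`exists_flat_sections`) then gives local solutions with any initial value at `p`.

The Hermitian form `e^{cφ} diag(1, c g)` is parallel for this connection (`wirt_tractorForm`). For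
solutions `s₀, …, sₙ` adapted to it at `p`, the form `s₀ s₀* + c ∑ sₘ sₘ*` is parallel too and
agrees with it at `p`, hence nearby (`exists_ball_hermitian_eq_zero`). Its first entry says `e^{cφ}
= |h₀|² + c ∑ |hₘ|²` with holomorphic `hₘ`. The coordinates are `fᵐ = hₘ / h₀`: then `log (1 +
c|f|²) = cφ - log |h₀|²`, and `log |h₀|²` is pluriharmonic, so both sides have complex Hessian `c
g`. As `c² = 1`, this is the claim, and positivity of `1 + c|f|²` gives `|f| < 1` when `c = -1`. -/

noncomputable section

open Set Metric Filter Topology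

/-! ### Frobenius theorem for linear total differential equations. -/

section LinearTotalDifferentialEquation

variable {E V R : Type*} [NormedAddCommGroup E] [NormedSpace ℝ E] [NormedAddCommGroup V]
  [NormedSpace ℝ V] [NormedRing R] [NormedAlgebra ℝ R]

/-- A linear ODE on `[0, 1]` whose coefficient has norm at most `1 / 2` is solvable. -/
theorem exists_linear_ode_solution [CompleteSpace R] {B : ℝ → R}
    (hB : ContinuousOn B (Icc 0 1)) (hB' : ∀ t ∈ Icc (0 : ℝ) 1, ‖B t‖ ≤ 1 / 2) (s : R) :
    ∃ y : ℝ → R, y 0 = s ∧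
      ∀ t ∈ Icc (0 : ℝ) 1, HasDerivWithinAt y (B t * y t) (Icc 0 1) t := by
  -- On the ball of radius `‖s‖` about `s` the field has norm at most `1/2 · 2‖s‖ = ‖s‖`, so a
  -- solution cannot leave the ball within unit time.
  have h : IsPicardLindelof (fun t y => B t * y) (tmin := 0) (tmax := 1) ⟨0, by simp⟩ s ‖s‖₊ 0
      ‖s‖₊ (1 / 2) := by
    refine ⟨fun t ht => ?_, fun x _ => hB.mul continuousOn_const, fun t ht x hx => ?_, ?_⟩
    · refine LipschitzWith.lipschitzOnWith (LipschitzWith.of_dist_le_mul fun x y => ?_)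
      rw [dist_eq_norm, dist_eq_norm, ← mul_sub]
      refine (norm_mul_le _ _).trans ?_
      gcongr
      simpa using hB' t ht
    · have hx' : ‖x‖ ≤ 2 * ‖s‖ := by
        rw [mem_closedBall, dist_eq_norm] at hx
        have := norm_sub_norm_le x s
        simp at hx
        linarith
      calc ‖B t * x‖ ≤ ‖B t‖ * ‖x‖ := norm_mul_le _ _
        _ ≤ 1 / 2 * (2 * ‖s‖) := by gcongr; exact hB' t ht
        _ = _ := by simp
    · simp
  exact h.exists_eq_forall_mem_Icc_hasDerivWithinAt₀

/-- Local bounds for a `C²` map: boundedness, a Lipschitz bound and a second order Taylor bound. -/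
theorem ContDiffAt.exists_ball_taylor_bound {f : E → V} {p : E} (hf : ContDiffAt ℝ 2 f p) :
    ∃ r > 0, ∃ M > 0, ∀ x ∈ ball p r, DifferentiableAt ℝ f x ∧ ‖f x‖ ≤ M ∧ ‖fderiv ℝ f x‖ ≤ M ∧
      ∀ y ∈ ball p r, ‖f y - f x‖ ≤ M * ‖y - x‖ ∧
        ‖f y - f x - fderiv ℝ f x (y - x)‖ ≤ M * ‖y - x‖ ^ 2 := by
  have hd : ContDiffAt ℝ 1 (fderiv ℝ f) p := hf.fderiv_right (by norm_num)
  have e1 : ∀ᶠ x in 𝓝 p, ContDiffAt ℝ 2 f x := hf.eventually (by simp)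
  obtain ⟨K, t, ht, hK⟩ := hd.exists_lipschitzOnWith
  have e2 : ∀ᶠ x in 𝓝 p, ‖f x‖ < ‖f p‖ + 1 :=
    hf.continuousAt.norm.eventually_lt_const (by linarith)
  have e3 : ∀ᶠ x in 𝓝 p, ‖fderiv ℝ f x‖ < ‖fderiv ℝ f p‖ + 1 :=
    hd.continuousAt.norm.eventually_lt_const (by linarith)
  obtain ⟨r, hr, H⟩ := Metric.eventually_nhds_iff_ball.1 (e1.and (e2.and (e3.and ht)))
  have h0 := norm_nonneg (f p)
  have h1 := norm_nonneg (fderiv ℝ f p)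
  have h2 : (0 : ℝ) ≤ K := K.2
  refine ⟨r, hr, ‖f p‖ + ‖fderiv ℝ f p‖ + K + 1, by positivity, fun x hx => ?_⟩
  have hdiff : ∀ z ∈ ball p r, DifferentiableAt ℝ f z := fun z hz =>
    (H z hz).1.differentiableAt (by norm_num)
  refine ⟨hdiff x hx, by linarith [(H x hx).2.1], by linarith [(H x hx).2.2.1], fun y hy => ⟨?_, ?_⟩⟩
  · refine (convex_ball p r).norm_image_sub_le_of_norm_fderiv_le (𝕜 := ℝ) hdiff
      (fun z hz => ?_) hx hy
    linarith [(H z hz).2.2.1]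
  · have hseg : segment ℝ x y ⊆ ball p r := (convex_ball p r).segment_subset hx hy
    have : ‖f y - f x - fderiv ℝ f x (y - x)‖ ≤ (K * ‖y - x‖) * ‖y - x‖ := by
      refine (convex_segment x y).norm_image_sub_le_of_norm_hasFDerivWithin_le'
        (f' := fderiv ℝ f) (fun z hz => (hdiff z (hseg hz)).hasFDerivAt.hasFDerivWithinAt)
        (fun z hz => ?_) (left_mem_segment ℝ x y) (right_mem_segment ℝ x y)
      have := hK.dist_le_mul z (H z (hseg hz)).2.2.2 x (H x hx).2.2.2
      rw [dist_eq_norm, dist_eq_norm] at this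
      refine this.trans ?_
      gcongr
      exact norm_sub_le_of_mem_segment hz
    nlinarith [sq_nonneg ‖y - x‖]

/-- The estimate behind differentiability of the solution: `A₀`, `A₁` are the values of the
coefficient at two nearby points of neighbouring rays, and `F` is its derivative at the first. -/
theorem norm_linear_defect_deriv_le {A₀ A₁ : E →L[ℝ] R} {F : E →L[ℝ] E →L[ℝ] R}
    {v h : E} {t M Y r : ℝ} {y z : R} (ht : t ∈ Icc (0 : ℝ) 1)
    (flat : F v h + A₀ h * A₀ v = F h v + A₀ v * A₀ h)
    (hA : ‖A₀‖ ≤ M) (hF : ‖F‖ ≤ M) (hL : ‖A₁ - A₀‖ ≤ M * ‖t • h‖)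
    (hQ : ‖A₁ - A₀ - F (t • h)‖ ≤ M * ‖t • h‖ ^ 2) (hvh : ‖v + h‖ ≤ r) (hY : ‖y‖ ≤ Y)
    (hA1 : ‖A₁ (v + h)‖ ≤ 1) :
    ‖A₁ (v + h) * z - A₀ v * y - (t • (F v h * y + A₀ h * (A₀ v * y)) + A₀ h * y)‖
      ≤ 1 * ‖z - y - t • (A₀ h * y)‖ + M * Y * (r + 1 + (r + 1) * M) * ‖h‖ ^ 2 := by
  have hM : 0 ≤ M := (norm_nonneg _).trans hA
  have hY0 : 0 ≤ Y := (norm_nonneg _).trans hY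
  have hr : 0 ≤ r := (norm_nonneg _).trans hvh
  have ht' : ‖t • h‖ ≤ ‖h‖ := by
    rw [norm_smul, Real.norm_eq_abs, abs_of_nonneg ht.1]
    exact mul_le_of_le_one_left (norm_nonneg _) ht.2
  have flat' : F v h = F h v + A₀ v * A₀ h - A₀ h * A₀ v := by rw [← flat]; abel
  -- Flatness trades `F v h` for `F h v` plus a commutator. The terms linear in `h` then cancel, and
  -- apart from a multiple of the defect `z - y - t • (A₀ h * y)` only terms quadratic in `h`
  -- remain.
  have hform : A₁ (v + h) * z - A₀ v * y - (t • (F v h * y + A₀ h * (A₀ v * y)) + A₀ h * y)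
      = A₁ (v + h) * (z - y - t • (A₀ h * y)) + ((A₁ - A₀ - F (t • h)) (v + h) * y
        + t • (F h h * y) + t • ((A₁ - A₀) (v + h) * (A₀ h * y) + A₀ h * (A₀ h * y))) := by
    rw [flat']
    simp only [map_add, map_smul, sub_apply, smul_apply, mul_sub, add_mul, sub_mul,
      mul_smul_comm, smul_mul_assoc, mul_assoc]
    module
  have hsmul : ∀ {x : R} {b : ℝ}, ‖x‖ ≤ b → ‖t • x‖ ≤ b := fun {x b} hx => by
    rw [norm_smul, Real.norm_eq_abs, abs_of_nonneg ht.1]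
    exact (mul_le_of_le_one_left (norm_nonneg _) ht.2).trans hx
  have hmul : ∀ {a b : R} {m n : ℝ}, ‖a‖ ≤ m → ‖b‖ ≤ n → ‖a * b‖ ≤ m * n := fun ha hb =>
    (norm_mul_le _ _).trans (mul_le_mul ha hb (norm_nonneg _) ((norm_nonneg _).trans ha))
  have n0 : ‖A₀ h‖ ≤ M * ‖h‖ := (A₀.le_opNorm _).trans (by gcongr)
  have n1 : ‖(A₁ - A₀ - F (t • h)) (v + h) * y‖ ≤ M * ‖h‖ ^ 2 * r * Y := by
    refine hmul ((ContinuousLinearMap.le_opNorm _ _).trans ?_) hY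
    have : ‖A₁ - A₀ - F (t • h)‖ ≤ M * ‖h‖ ^ 2 := hQ.trans (by gcongr)
    gcongr
  have n2 : ‖t • (F h h * y)‖ ≤ M * ‖h‖ * ‖h‖ * Y := by
    refine hsmul (hmul ((ContinuousLinearMap.le_opNorm _ _).trans ?_) hY)
    have : ‖F h‖ ≤ M * ‖h‖ := (ContinuousLinearMap.le_opNorm _ _).trans (by gcongr)
    gcongr
  have n3 : ‖t • ((A₁ - A₀) (v + h) * (A₀ h * y) + A₀ h * (A₀ h * y))‖
      ≤ M * ‖h‖ * r * (M * ‖h‖ * Y) + M * ‖h‖ * (M * ‖h‖ * Y) := by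
    refine hsmul ((norm_add_le _ _).trans (add_le_add ?_ ?_))
    · refine hmul ((ContinuousLinearMap.le_opNorm _ _).trans ?_) (hmul n0 hY)
      have : ‖A₁ - A₀‖ ≤ M * ‖h‖ := hL.trans (by gcongr)
      gcongr
    · exact hmul n0 (hmul n0 hY)
  have n4 : ‖A₁ (v + h) * (z - y - t • (A₀ h * y))‖ ≤ 1 * ‖z - y - t • (A₀ h * y)‖ :=
    hmul hA1 le_rfl
  rw [hform]
  refine (norm_add_le _ _).trans (add_le_add n4 ?_)
  refine (norm_add₃_le).trans ((add_le_add (add_le_add n1 n2) n3).trans (le_of_eq ?_))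
  ring

/-- The linear total differential equation `dS = A S` with flat coefficient `A` is locally
solvable with any initial value, on a ball that does not depend on the initial value. -/
theorem exists_hasFDerivAt_eq_of_flat [CompleteSpace R] {A : E → E →L[ℝ] R} {p : E}
    (hA : ContDiffAt ℝ 2 A p)
    (flat : ∀ᶠ x in 𝓝 p, ∀ v w, fderiv ℝ A x v w + A x w * A x v
      = fderiv ℝ A x w v + A x v * A x w) :
    ∃ r > 0, ∀ s : R, ∃ S : E → R, S p = s ∧
      ∀ x ∈ ball p r, ∃ L : E →L[ℝ] R, HasFDerivAt S L x ∧ ∀ v, L v = A x v * S x := by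
  obtain ⟨r₁, hr₁, M, hM, H⟩ := hA.exists_ball_taylor_bound
  obtain ⟨r₂, hr₂, hflat⟩ := Metric.eventually_nhds_iff_ball.1 flat
  -- The bound `1 / (2M)` makes the coefficient of the radial equation at most `1/2` on every ray,
  -- independently of the initial value.
  set r := min (min r₁ r₂) (1 / (2 * M)) with hr
  have hr0 : 0 < r := by positivity
  have hr1 : ball p r ⊆ ball p r₁ :=
    ball_subset_ball ((min_le_left _ _).trans (min_le_left _ _))
  have hr2 : ball p r ⊆ ball p r₂ :=
    ball_subset_ball ((min_le_left _ _).trans (min_le_right _ _))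
  have hrM : M * r ≤ 1 / 2 := by
    have : r ≤ 1 / (2 * M) := min_le_right _ _
    calc M * r ≤ M * (1 / (2 * M)) := by gcongr
      _ = 1 / 2 := by field_simp
  have hmem : ∀ v : E, ‖v‖ < r → ∀ t ∈ Icc (0 : ℝ) 1, p + t • v ∈ ball p r := by
    intro v hv t ht
    rw [mem_ball, dist_eq_norm, add_sub_cancel_left, norm_smul, Real.norm_eq_abs, abs_of_nonneg ht.1]
    nlinarith [ht.2, norm_nonneg v]
  have hAv : ∀ v : E, ‖v‖ < r → ∀ t ∈ Icc (0 : ℝ) 1, ‖A (p + t • v) v‖ ≤ 1 / 2 := by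
    intro v hv t ht
    have h1 := (H _ (hr1 (hmem v hv t ht))).2.1
    calc ‖A (p + t • v) v‖ ≤ ‖A (p + t • v)‖ * ‖v‖ := (A _).le_opNorm v
      _ ≤ M * r := by gcongr
      _ ≤ _ := hrM
  have hline : ∀ (v : E) (t : ℝ), HasDerivAt (fun t : ℝ => p + t • v) v t := fun v t => by
    simpa using ((hasDerivAt_id t).smul_const v).const_add p
  have hAline : ∀ v : E, ‖v‖ < r → ∀ t ∈ Icc (0 : ℝ) 1,
      HasDerivAt (fun t : ℝ => A (p + t • v)) (fderiv ℝ A (p + t • v) v) t := fun v hv t ht =>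
    HasFDerivAt.comp_hasDerivAt (l := A) (f := fun t : ℝ => p + t • v) t
      (H _ (hr1 (hmem v hv t ht))).1.hasFDerivAt (hline v t)
  refine ⟨r, hr0, fun s => ?_⟩
  have hex : ∀ v : E, ∃ y : ℝ → R, ‖v‖ < r → y 0 = s ∧
      ∀ t ∈ Icc (0 : ℝ) 1, HasDerivWithinAt y (A (p + t • v) v * y t) (Icc 0 1) t := by
    intro v
    by_cases hv : ‖v‖ < r
    · obtain ⟨y, hy⟩ := exists_linear_ode_solution (B := fun t => A (p + t • v) v)
        (fun t ht => ((hAline v hv t ht).clm_apply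
          (hasDerivAt_const t v)).continuousAt.continuousWithinAt) (hAv v hv) s
      exact ⟨y, fun _ => hy⟩
    · exact ⟨0, fun h => absurd h hv⟩
  choose y hy using hex
  -- `S x` is the value at time 1 of the solution of the equation restricted to the segment from `p`
  -- to `x`. Flatness is needed only to differentiate across rays.
  refine ⟨fun x => y (x - p) 1, ?_, fun x hx => ?_⟩
  · have h0 := hy 0 (by simpa using hr0)
    have : ∀ t ∈ Icc (0 : ℝ) 1, y 0 t = y 0 0 := by
      refine constant_of_has_deriv_right_zero
        (fun t ht => (h0.2 t ht).continuousWithinAt) (fun t ht => ?_)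
      have := h0.2 t ⟨ht.1, ht.2.le⟩
      rw [map_zero, zero_mul] at this
      exact (this.mono_of_mem_nhdsWithin (Icc_mem_nhdsGE_of_mem ht))
    simp only [sub_self]
    rw [this 1 (by simp), h0.1]
  set v := x - p with hv
  have hxv : x = p + v := by rw [hv]; abel
  have hvr : ‖v‖ < r := by rwa [mem_ball, dist_eq_norm] at hx
  obtain ⟨hy0, hyd⟩ := hy v hvr
  obtain ⟨Y, hY⟩ := isCompact_Icc.exists_bound_of_continuousOn
    (fun t ht => (hyd t ht).continuousWithinAt)
  have hY0 : 0 ≤ Y := (norm_nonneg _).trans (hY 0 (by simp))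
  set C := M * Y * (r + 1 + (r + 1) * M) with hC
  have hC0 : 0 ≤ C := by positivity
  have key : ∀ h : E, ‖v + h‖ < r → ‖y (v + h) 1 - y v 1 - A x h * y v 1‖ ≤ 2 * C * ‖h‖ ^ 2 := by
    intro h hvh
    obtain ⟨hz0, hzd⟩ := hy (v + h) hvh
    -- If `dS = A S`, the variation of the ray solution in direction `h` at time `t` is `t A(p + tv)
    -- h y(t)`. `D` is the error of this prediction, and Gronwall bounds it by a multiple of `‖h‖²`.
    set D : ℝ → R := fun t => y (v + h) t - y v t - t • (A (p + t • v) h * y v t) with hD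
    set D' : ℝ → R := fun t => A (p + t • (v + h)) (v + h) * y (v + h) t - A (p + t • v) v * y v t
      - (t • (fderiv ℝ A (p + t • v) v h * y v t + A (p + t • v) h * (A (p + t • v) v * y v t))
        + A (p + t • v) h * y v t) with hD'
    have hDd : ∀ t ∈ Icc (0 : ℝ) 1, HasDerivWithinAt D (D' t) (Icc 0 1) t := by
      intro t ht
      have h1 := (((hAline v hvr t ht).hasDerivWithinAt (s := Icc 0 1)).clm_apply
        (hasDerivWithinAt_const t (Icc 0 1) h)).mul (hyd t ht)
      have h2 := ((hzd t ht).sub (hyd t ht)).sub ((hasDerivWithinAt_id t (Icc 0 1)).smul h1)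
      refine h2.congr_deriv ?_
      simp [hD']
    have hbound : ∀ t ∈ Icc (0 : ℝ) 1, ‖D' t‖ ≤ 1 * ‖D t‖ + C * ‖h‖ ^ 2 := by
      intro t ht
      have hx1 := hmem v hvr t ht
      have hx2 := hmem (v + h) hvh t ht
      have hba : p + t • (v + h) - (p + t • v) = t • h := by rw [smul_add]; abel
      obtain ⟨-, Ha, -, Hab⟩ := H _ (hr1 hx1)
      obtain ⟨Hl, Hq⟩ := Hab _ (hr1 hx2)
      have Hd := (H _ (hr1 hx1)).2.2.1
      rw [hba] at Hl Hq
      exact norm_linear_defect_deriv_le ht (hflat _ (hr2 hx1) v h) Ha Hd Hl Hq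
        hvh.le (hY t ht) ((hAv (v + h) hvh t ht).trans (by norm_num))
    have hD0 : ‖D 0‖ ≤ 0 := by simp [hD, hy0, hz0]
    have := norm_le_gronwallBound_of_norm_deriv_right_le (f := D) (f' := D') (δ := 0) (K := 1)
      (ε := C * ‖h‖ ^ 2) (a := 0) (b := 1) (fun t ht => (hDd t ht).continuousWithinAt)
      (fun t ht => (hDd t ⟨ht.1, ht.2.le⟩).mono_of_mem_nhdsWithin (Icc_mem_nhdsGE_of_mem ht)) hD0
      (fun t ht => hbound t ⟨ht.1, ht.2.le⟩) 1 (by simp)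
    rw [gronwallBound_of_K_ne_0 one_ne_zero] at this
    simp only [hD, one_smul, ← hxv] at this
    refine this.trans ?_
    -- Gronwall with `K = 1` on `[0, 1]` gives the factor `e - 1`, which is less than 2.
    have he := Real.exp_one_lt_d9
    have : 0 ≤ C * ‖h‖ ^ 2 := by positivity
    norm_num
    nlinarith
  refine ⟨(ContinuousLinearMap.mul ℝ R).flip (y v 1) ∘L A x, ?_, fun w => rfl⟩
  rw [hasFDerivAt_iff_isLittleO_nhds_zero]
  have hO : (fun h : E => y (x + h - p) 1 - y (x - p) 1 - ((ContinuousLinearMap.mul ℝ R).flip (y v 1) ∘L A x) h)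
      =O[𝓝 0] fun h => ‖h‖ ^ 2 := by
    refine Asymptotics.IsBigO.of_bound (2 * C) ?_
    have : ∀ᶠ h : E in 𝓝 0, ‖v + h‖ < r := by
      have : ContinuousAt (fun h : E => ‖v + h‖) 0 := by fun_prop
      exact this.eventually_lt_const (by simpa using hvr)
    filter_upwards [this] with h hh
    have e : x + h - p = v + h := by rw [hv]; abel
    rw [e, ← hv, norm_pow, norm_norm]
    exact key h hh
  exact hO.trans_isLittleO (Asymptotics.isLittleO_norm_pow_id one_lt_two)

/-- A solution of a linear differential inequality that vanishes at the centre of a ball vanishes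
on the ball. -/
theorem eq_zero_on_ball_of_norm_fderiv_le {D : E → V} {D' : E → E →L[ℝ] V} {p : E} {r K : ℝ}
    (hD : ∀ x ∈ ball p r, HasFDerivAt D (D' x) x) (hK : ∀ x ∈ ball p r, ‖D' x‖ ≤ K * ‖D x‖)
    (h0 : D p = 0) : ∀ x ∈ ball p r, D x = 0 := by
  intro x hx
  set v := x - p with hv
  have hvr : ‖v‖ < r := by rwa [mem_ball, dist_eq_norm] at hx
  have hmem : ∀ t ∈ Icc (0 : ℝ) 1, p + t • v ∈ ball p r := by
    intro t ht
    rw [mem_ball, dist_eq_norm, add_sub_cancel_left, norm_smul, Real.norm_eq_abs, abs_of_nonneg ht.1]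
    nlinarith [ht.2, norm_nonneg v]
  have hline : ∀ t : ℝ, HasDerivAt (fun t : ℝ => p + t • v) v t := fun t => by
    simpa using ((hasDerivAt_id t).smul_const v).const_add p
  have hd : ∀ t ∈ Icc (0 : ℝ) 1,
      HasDerivAt (fun t : ℝ => D (p + t • v)) (D' (p + t • v) v) t := fun t ht =>
    HasFDerivAt.comp_hasDerivAt (l := D) (f := fun t : ℝ => p + t • v) t (hD _ (hmem t ht)) (hline t)
  have := norm_le_gronwallBound_of_norm_deriv_right_le (f := fun t : ℝ => D (p + t • v))
      (f' := fun t => D' (p + t • v) v) (δ := 0) (K := K * ‖v‖)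
      (ε := 0) (a := 0) (b := 1) (fun t ht => (hd t ht).continuousAt.continuousWithinAt)
      (fun t ht => (hd t ⟨ht.1, ht.2.le⟩).hasDerivWithinAt) (by simp [h0])
      (fun t ht => by
        refine ((D' _).le_opNorm v).trans ?_
        have := hK _ (hmem t ⟨ht.1, ht.2.le⟩)
        nlinarith [norm_nonneg v]) 1 (by simp)
  rw [gronwallBound_ε0_δ0] at this
  simpa [hv] using this

end LinearTotalDifferentialEquation

/-! ### Wirtinger calculus. -/

namespace KahlerBall

variable {n : ℕ} {U : Set (Cn n)} {f g : Cn n → ℂ} {φ : Cn n → ℝ} {z : Cn n} {c : ℝ}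

/-- The Wirtinger functionals on real-linear maps: `inl i` gives `∂ᵢ` and `inr i` gives `∂_{ī}`. -/
def wirtL (d : Fin n ⊕ Fin n) : (Cn n →L[ℝ] ℂ) →L[ℝ] ℂ :=
  Sum.elim
    (fun i => (2⁻¹ : ℂ) • (ContinuousLinearMap.apply ℝ ℂ (EuclideanSpace.single i 1)
      - Complex.I • ContinuousLinearMap.apply ℝ ℂ (EuclideanSpace.single i Complex.I)))
    (fun i => (2⁻¹ : ℂ) • (ContinuousLinearMap.apply ℝ ℂ (EuclideanSpace.single i 1)
      + Complex.I • ContinuousLinearMap.apply ℝ ℂ (EuclideanSpace.single i Complex.I))) d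

/-- The Wirtinger derivatives, indexed so that `inl i` gives `∂ᵢ` and `inr i` gives `∂_{ī}`. -/
def wirt (d : Fin n ⊕ Fin n) (f : Cn n → ℂ) (z : Cn n) : ℂ := wirtL d (fderiv ℝ f z)

theorem wirt_inl (i : Fin n) : wirt (Sum.inl i) = dz i := by
  funext f z
  simp [wirt, wirtL, dz]
  ring

theorem wirt_inr (i : Fin n) : wirt (Sum.inr i) = dzbar i := by
  funext f z
  simp [wirt, wirtL, dzbar]
  ring

theorem wirtL_smul (d : Fin n ⊕ Fin n) (a : ℂ) (L : Cn n →L[ℝ] ℂ) :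
    wirtL d (a • L) = a * wirtL d L := by
  rcases d with i | i <;> simp [wirtL] <;> ring

theorem wirtL_conj (d : Fin n ⊕ Fin n) (L : Cn n →L[ℝ] ℂ) :
    wirtL d ((Complex.conjCLE : ℂ →L[ℝ] ℂ) ∘L L) = conj (wirtL d.swap L) := by
  rcases d with i | i <;> simp [wirtL, Complex.conj_ofNat] <;> ring

/-- The coframe `dzⁱ`, `dz̄ⁱ` dual to the Wirtinger derivatives. -/
def coframe (d : Fin n ⊕ Fin n) : Cn n →L[ℝ] ℂ :=
  Sum.elim (fun i => (EuclideanSpace.proj i : Cn n →L[ℂ] ℂ).restrictScalars ℝ)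
    (fun i => (Complex.conjCLE : ℂ →L[ℝ] ℂ) ∘L
      (EuclideanSpace.proj i : Cn n →L[ℂ] ℂ).restrictScalars ℝ) d

theorem coframe_inl (i : Fin n) (v : Cn n) : coframe (Sum.inl i) v = v i := rfl

theorem coframe_inr (i : Fin n) (v : Cn n) : coframe (Sum.inr i) v = conj (v i) := rfl

theorem wirtL_coframe (d e : Fin n ⊕ Fin n) : wirtL d (coframe e) = if d = e then 1 else 0 := by
  rcases d with i | i <;> rcases e with j | j <;> rcases eq_or_ne i j with rfl | h <;>
    simp [wirtL, coframe, ← two_mul, *]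

/-- This is `df = ∑ ∂ᵢf dzⁱ + ∑ ∂_{ī}f dz̄ⁱ`, checked on the real basis `eᵢ, √-1 eᵢ`. It turns
statements about total derivatives into statements about Wirtinger derivatives. -/
theorem sum_coframe_mul_wirtL (L : Cn n →L[ℝ] ℂ) (v : Cn n) :
    L v = ∑ d, coframe d v * wirtL d L := by
  have hv : v = ∑ i, ((v i).re • EuclideanSpace.single i (1 : ℂ)
      + (v i).im • EuclideanSpace.single i Complex.I) := by
    ext j
    simp [Finset.sum_apply, Pi.single_apply, Finset.sum_add_distrib]
  conv_lhs => rw [hv]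
  rw [map_sum, Fintype.sum_sum_type, ← Finset.sum_add_distrib]
  refine Finset.sum_congr rfl fun i _ => ?_
  simp only [coframe_inl, coframe_inr, map_add, map_smul, wirtL, Sum.elim_inl, Sum.elim_inr,
    smul_apply, sub_apply, add_apply, ContinuousLinearMap.apply_apply, smul_eq_mul,
    Complex.real_smul]
  conv_rhs => rw [← Complex.re_add_im (v i)]
  simp only [map_add, map_mul, Complex.conj_ofReal, Complex.conj_I]
  ring_nf
  simp only [Complex.I_sq]
  ring

theorem wirt_congr (d : Fin n ⊕ Fin n) (h : f =ᶠ[𝓝 z] g) : wirt d f z = wirt d g z := by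
  rw [wirt, wirt, h.fderiv_eq]

theorem wirt_congr_on (hU : IsOpen U) (h : ∀ w ∈ U, f w = g w) (hz : z ∈ U)
    (d : Fin n ⊕ Fin n) : wirt d f z = wirt d g z :=
  wirt_congr d (eventually_of_mem (hU.mem_nhds hz) h)

theorem wirt_const (d : Fin n ⊕ Fin n) (a : ℂ) : wirt d (fun _ => a) z = 0 := by
  simp [wirt]

theorem wirt_add (d : Fin n ⊕ Fin n) (hf : DifferentiableAt ℝ f z) (hg : DifferentiableAt ℝ g z) :
    wirt d (fun w => f w + g w) z = wirt d f z + wirt d g z := by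
  rw [wirt, fderiv_fun_add hf hg, map_add, wirt, wirt]

theorem wirt_sub (d : Fin n ⊕ Fin n) (hf : DifferentiableAt ℝ f z) (hg : DifferentiableAt ℝ g z) :
    wirt d (fun w => f w - g w) z = wirt d f z - wirt d g z := by
  rw [wirt, fderiv_fun_sub hf hg, map_sub, wirt, wirt]

theorem wirt_neg (d : Fin n ⊕ Fin n) : wirt d (fun w => -f w) z = -wirt d f z := by
  rw [wirt, fderiv_fun_neg, map_neg, wirt]

theorem wirt_mul (d : Fin n ⊕ Fin n) (hf : DifferentiableAt ℝ f z) (hg : DifferentiableAt ℝ g z) :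
    wirt d (fun w => f w * g w) z = wirt d f z * g z + f z * wirt d g z := by
  rw [wirt, fderiv_fun_mul hf hg, map_add, wirtL_smul, wirtL_smul, wirt, wirt]
  ring

theorem wirt_const_mul (d : Fin n ⊕ Fin n) (a : ℂ) (hf : DifferentiableAt ℝ f z) :
    wirt d (fun w => a * f w) z = a * wirt d f z := by
  rw [wirt_mul d (differentiableAt_const a) hf, wirt_const, zero_mul, zero_add]

theorem wirt_sum {ι : Type*} (s : Finset ι) (d : Fin n ⊕ Fin n) {F : ι → Cn n → ℂ}
    (hF : ∀ a ∈ s, DifferentiableAt ℝ (F a) z) :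
    wirt d (fun w => ∑ a ∈ s, F a w) z = ∑ a ∈ s, wirt d (F a) z := by
  rw [wirt, fderiv_fun_sum hF, map_sum]
  rfl

theorem wirt_conj (d : Fin n ⊕ Fin n) (hf : DifferentiableAt ℝ f z) :
    wirt d (fun w => conj (f w)) z = conj (wirt d.swap f z) := by
  have := ((Complex.conjCLE : ℂ →L[ℝ] ℂ).hasFDerivAt.comp z hf.hasFDerivAt).fderiv
  rw [wirt, wirt, ← wirtL_conj, ← this]
  rfl

theorem wirt_comp (d : Fin n ⊕ Fin n) {F : ℂ → ℂ} {F' : ℂ} (hF : HasDerivAt F F' (f z))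
    (hf : DifferentiableAt ℝ f z) : wirt d (fun w => F (f w)) z = F' * wirt d f z := by
  have := (HasFDerivAt.comp z (hF.hasFDerivAt.restrictScalars ℝ) hf.hasFDerivAt).fderiv
  change wirtL d (fderiv ℝ (F ∘ f) z) = _
  rw [this, wirt, ← wirtL_smul]
  congr 1
  ext v
  simp [mul_comm]

theorem wirt_contDiffOn (hU : IsOpen U) (hf : ContDiffOn ℝ ∞ f U) (d : Fin n ⊕ Fin n) :
    ContDiffOn ℝ ∞ (wirt d f) U :=
  (wirtL d).contDiff.comp_contDiffOn (hf.fderiv_of_isOpen hU (by simp))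

/-- A common shape for `∂ᵢ` and `∂_{ī}`, so that their commutation follows from symmetry of the real
second derivative without splitting into types. -/
theorem exists_wirtL_eq (d : Fin n ⊕ Fin n) :
    ∃ (v w : Cn n) (b : ℂ), ∀ L, wirtL d L = 2⁻¹ * (L v + b * L w) := by
  rcases d with i | i
  · exact ⟨EuclideanSpace.single i 1, EuclideanSpace.single i Complex.I, -Complex.I,
      fun L => by simp [wirtL]; ring⟩
  · exact ⟨EuclideanSpace.single i 1, EuclideanSpace.single i Complex.I, Complex.I,
      fun L => by simp [wirtL]; ring⟩

theorem wirt_comm (hU : IsOpen U) (hf : ContDiffOn ℝ ∞ f U) (hz : z ∈ U) (d e : Fin n ⊕ Fin n) :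
    wirt d (wirt e f) z = wirt e (wirt d f) z := by
  have hf' : ContDiffAt ℝ ∞ f z := hf.contDiffAt (hU.mem_nhds hz)
  have hsymm : IsSymmSndFDerivAt ℝ f z := hf'.isSymmSndFDerivAt (by simp; exact WithTop.coe_le_coe.2 le_top)
  have hd : DifferentiableAt ℝ (fderiv ℝ f) z :=
    (hf'.fderiv_right (m := ∞) (by simp)).differentiableAt (by simp)
  have key : ∀ d : Fin n ⊕ Fin n, ∀ v : Cn n,
      fderiv ℝ (wirt d f) z v = wirtL d (fderiv ℝ (fderiv ℝ f) z v) := by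
    intro d v
    have := ((wirtL d).hasFDerivAt.comp z hd.hasFDerivAt).fderiv
    change fderiv ℝ (wirtL d ∘ fderiv ℝ f) z v = _
    rw [this]
    rfl
  have hflip : ∀ v w, fderiv ℝ (fderiv ℝ f) z v w = fderiv ℝ (fderiv ℝ f) z w v := hsymm
  obtain ⟨v, w, b, hd'⟩ := exists_wirtL_eq d
  obtain ⟨v', w', b', he'⟩ := exists_wirtL_eq e
  rw [wirt, hd', wirt, he', key, key, key, key, he', he', hd', hd', hflip v, hflip v, hflip w,
    hflip w]
  ring

/-- A real-differentiable function killed by all `∂_{ī}` is complex differentiable. -/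
theorem hasFDerivAt_of_dzbar_eq_zero (hf : DifferentiableAt ℝ f z)
    (h : ∀ i, wirt (Sum.inr i) f z = 0) :
    HasFDerivAt f (∑ i, wirt (Sum.inl i) f z • (EuclideanSpace.proj i : Cn n →L[ℂ] ℂ)) z := by
  refine hasFDerivAt_of_restrictScalars ℝ hf.hasFDerivAt ?_
  ext v
  rw [sum_coframe_mul_wirtL (fderiv ℝ f z) v, Fintype.sum_sum_type]
  simp only [wirt] at h
  simp [h, wirt, coframe_inl, mul_comm]

/-! ### Flat linear systems in Wirtinger derivatives. -/

section FlatSystem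

variable {ι : Type*} [Fintype ι]

variable {R : Type*} [NormedRing R] [NormedAlgebra ℂ R]

/-- The 1-form `b θ`, as a continuous linear function of `b`, where `θ` is an element of the
coframe. -/
def coframeSMul (d : Fin n ⊕ Fin n) : R →L[ℝ] Cn n →L[ℝ] R :=
  (ContinuousLinearMap.compL ℝ (Cn n) ℂ R).flip (coframe d) ∘L
    (ContinuousLinearMap.lsmul ℝ ℂ : ℂ →L[ℝ] R →L[ℝ] R).flip

theorem coframeSMul_apply (d : Fin n ⊕ Fin n) (b : R) (v : Cn n) :
    coframeSMul d b v = coframe d v • b := rfl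

/-- Local solvability of a flat linear system of first order equations `∂_d S = P_d S`, where the
matrices `P_d` act through a representation `E` in a Banach algebra. -/
theorem exists_flat_sections_algebra [CompleteSpace R] (E : (ι → ι → ℂ) →L[ℝ] R)
    (hE : ∀ c c', E c * E c' = E fun a b => ∑ k, c a k * c' k b)
    (hE' : ∀ (t : ℂ) c, E (t • c) = t • E c)
    {P : Fin n ⊕ Fin n → ι → ι → Cn n → ℂ} (hU : IsOpen U)
    (hP : ∀ d a b, ContDiffOn ℝ ∞ (P d a b) U)
    (flat : ∀ x ∈ U, ∀ d e a b, wirt e (P d a b) x + ∑ c, P d a c x * P e c b x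
      = wirt d (P e a b) x + ∑ c, P e a c x * P d c b x) {p : Cn n} (hp : p ∈ U) :
    ∃ r > 0, ball p r ⊆ U ∧ ∃ S : Cn n → R, S p = 1 ∧ ∀ x ∈ ball p r,
      ∃ L : Cn n →L[ℝ] R, HasFDerivAt S L x ∧
        ∀ v, L v = ∑ d, coframe d v • (E (fun a b => P d a b x) * S x) := by
  set A : Cn n → Cn n →L[ℝ] R := fun x => ∑ d, coframeSMul d (E fun a b => P d a b x) with hA
  have hPx : ∀ x ∈ U, ∀ d a b, ContDiffAt ℝ ∞ (P d a b) x := fun x hx d a b =>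
    (hP d a b).contDiffAt (hU.mem_nhds hx)
  have hAapp : ∀ x v, A x v = ∑ d, coframe d v • E (fun a b => P d a b x) := fun x v => by
    simp [hA, sum_apply, coframeSMul_apply]
  have hAd : ∀ x ∈ U, ∀ v w, fderiv ℝ A x v w
      = ∑ d, coframe d w • ∑ e, coframe e v • E (fun a b => wirt e (P d a b) x) := by
    intro x hx v w
    have h1 : ∀ d, HasFDerivAt (fun x a b => P d a b x) (ContinuousLinearMap.pi fun a =>
        ContinuousLinearMap.pi fun b => fderiv ℝ (P d a b) x) x := fun d =>
      hasFDerivAt_pi.2 fun a => hasFDerivAt_pi.2 fun b =>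
        ((hPx x hx d a b).differentiableAt (by simp)).hasFDerivAt
    have h2 : ∀ d, HasFDerivAt (fun x => coframeSMul d (E fun a b => P d a b x))
        (coframeSMul d ∘L (E ∘L (ContinuousLinearMap.pi fun a =>
          ContinuousLinearMap.pi fun b => fderiv ℝ (P d a b) x))) x := fun d =>
      (coframeSMul d ∘L E).hasFDerivAt.comp x (h1 d)
    have h3 : HasFDerivAt A _ x := HasFDerivAt.fun_sum fun d _ => h2 d
    rw [h3.fderiv]
    simp only [sum_apply, ContinuousLinearMap.comp_apply, coframeSMul_apply]
    refine Finset.sum_congr rfl fun d _ => ?_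
    congr 1
    have h5 : (ContinuousLinearMap.pi fun a =>
        ContinuousLinearMap.pi fun b => fderiv ℝ (P d a b) x) v
        = ∑ e, coframe e v • fun a b => wirt e (P d a b) x := by
      funext a b
      simp only [Finset.sum_apply, Pi.smul_apply, smul_eq_mul]
      exact sum_coframe_mul_wirtL (fderiv ℝ (P d a b) x) v
    rw [h5, map_sum]
    simp only [hE']
  have hAs : ContDiffAt ℝ 2 A p := by
    refine ContDiffAt.sum fun d _ => (coframeSMul d).contDiff.contDiffAt.comp p
      (E.contDiff.contDiffAt.comp p (contDiffAt_pi.2 fun a => contDiffAt_pi.2 fun b => ?_))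
    exact (hPx p hp d a b).of_le (WithTop.coe_le_coe.2 le_top)
  have hflat : ∀ᶠ x in 𝓝 p, ∀ v w, fderiv ℝ A x v w + A x w * A x v
      = fderiv ℝ A x w v + A x v * A x w := by
    filter_upwards [hU.mem_nhds hp] with x hx v w
    have expand : ∀ v w, fderiv ℝ A x v w + A x w * A x v
        = ∑ d, ∑ e, (coframe d w * coframe e v) •
          E (fun a b => wirt e (P d a b) x + ∑ c, P d a c x * P e c b x) := by
      intro v w
      have h4 : ∀ d e, E (fun a b => wirt e (P d a b) x + ∑ c, P d a c x * P e c b x)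
          = E (fun a b => wirt e (P d a b) x)
            + E (fun a b => P d a b x) * E (fun a b => P e a b x) := by
        intro d e
        rw [hE, ← map_add]
        rfl
      simp only [hAd x hx v, hAapp, h4, smul_add, Finset.sum_add_distrib, Finset.smul_sum,
        mul_smul, Finset.sum_mul, Finset.mul_sum, smul_mul_assoc, mul_smul_comm]
      congr 1
      rw [Finset.sum_comm]
      refine Finset.sum_congr rfl fun d _ => Finset.sum_congr rfl fun e _ => ?_
      rw [smul_comm]
    rw [expand, expand, Finset.sum_comm]
    refine Finset.sum_congr rfl fun d _ => Finset.sum_congr rfl fun e _ => ?_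
    rw [mul_comm]
    congr 2
    funext a b
    exact flat x hx e d a b
  obtain ⟨r₁, hr₁, H⟩ := exists_hasFDerivAt_eq_of_flat hAs hflat
  obtain ⟨r₂, hr₂, hball⟩ := Metric.isOpen_iff.1 hU p hp
  obtain ⟨S, hS1, hS⟩ := H 1
  refine ⟨min r₁ r₂, lt_min hr₁ hr₂, (ball_subset_ball (min_le_right _ _)).trans hball,
    S, hS1, fun x hx => ?_⟩
  obtain ⟨L, hL, hL'⟩ := hS x (ball_subset_ball (min_le_left _ _) hx)
  refine ⟨L, hL, fun v => ?_⟩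
  simp only [hL', hAapp, Finset.sum_mul, smul_mul_assoc]

variable [DecidableEq ι]

/-- Matrices acting on Euclidean space, as a continuous linear map on arrays. -/
def arrayToCLM : (ι → ι → ℂ) →L[ℝ] (EuclideanSpace ℂ ι →L[ℂ] EuclideanSpace ℂ ι) :=
  LinearMap.toContinuousLinearMap
    (((Matrix.toEuclideanCLM (n := ι) (𝕜 := ℂ)).toAlgEquiv.toLinearMap ∘ₗ
      (Matrix.ofLinearEquiv ℂ : (ι → ι → ℂ) ≃ₗ[ℂ] Matrix ι ι ℂ).toLinearMap).restrictScalars ℝ)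

theorem arrayToCLM_eq (c : ι → ι → ℂ) :
    arrayToCLM c = Matrix.toEuclideanCLM (n := ι) (𝕜 := ℂ) (Matrix.of c) := rfl

/-- Local solvability of a flat linear system of first order equations `∂_d s = P_d s` prescribing
all Wirtinger derivatives. -/
theorem exists_flat_sections {P : Fin n ⊕ Fin n → ι → ι → Cn n → ℂ} (hU : IsOpen U)
    (hP : ∀ d a b, ContDiffOn ℝ ∞ (P d a b) U)
    (flat : ∀ x ∈ U, ∀ d e a b, wirt e (P d a b) x + ∑ c, P d a c x * P e c b x
      = wirt d (P e a b) x + ∑ c, P e a c x * P d c b x) {p : Cn n} (hp : p ∈ U) :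
    ∃ r > 0, ball p r ⊆ U ∧ ∀ s₀ : ι → ℂ, ∃ s : ι → Cn n → ℂ, (∀ a, s a p = s₀ a) ∧
      ∀ x ∈ ball p r, ∀ a, DifferentiableAt ℝ (s a) x ∧
        ∀ d, wirt d (s a) x = ∑ b, P d a b x * s b x := by
  obtain ⟨r, hr, hball, S, hS1, hS⟩ := exists_flat_sections_algebra (U := U) (P := P)
    (arrayToCLM (ι := ι)) (fun c c' => by
      rw [arrayToCLM_eq, arrayToCLM_eq, arrayToCLM_eq, ← map_mul]
      rfl) (fun t c => by rw [arrayToCLM_eq, arrayToCLM_eq, ← map_smul]; rfl) hU hP flat hp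
  -- The algebra-valued solution with `S p = 1` is a fundamental matrix; applied to `s₀` it solves
  -- every initial value problem on one and the same ball.
  refine ⟨r, hr, hball, fun s₀ => ⟨fun a x => S x (WithLp.toLp 2 s₀) a,
    fun a => by simp [hS1], fun x hx a => ?_⟩⟩
  obtain ⟨L, hL, hL'⟩ := hS x hx
  set T : (EuclideanSpace ℂ ι →L[ℂ] EuclideanSpace ℂ ι) →L[ℝ] ℂ :=
    ((EuclideanSpace.proj a : EuclideanSpace ℂ ι →L[ℂ] ℂ) ∘L
      (ContinuousLinearMap.apply ℂ (EuclideanSpace ℂ ι) (WithLp.toLp 2 s₀))).restrictScalars ℝ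
    with hT
  have hs : HasFDerivAt (fun x => S x (WithLp.toLp 2 s₀) a) (T ∘L L) x := T.hasFDerivAt.comp x hL
  refine ⟨hs.differentiableAt, fun d => ?_⟩
  have hTL : T ∘L L = ∑ e, (∑ b, P e a b x * S x (WithLp.toLp 2 s₀) b) • coframe e := by
    ext v
    simp [hT, hL', sum_apply, arrayToCLM_eq, Matrix.mulVec, dotProduct, mul_comm]
  rw [wirt, hs.fderiv, hTL, map_sum]
  simp [wirtL_smul, wirtL_coframe]

end FlatSystem

/-! ### Polarization of Kähler curvature tensors. -/

section Polarization

variable {V : Type*} [AddCommGroup V] [Module ℂ V]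

/-- A form that is additive in both variables, linear in the first and antilinear in the second,
is determined by its diagonal. -/
theorem sesquilinear_eq_zero {s : V → V → ℂ} (add_left : ∀ x y z, s (x + y) z = s x z + s y z)
    (add_right : ∀ x y z, s x (y + z) = s x y + s x z)
    (smul_left : ∀ (a : ℂ) x y, s (a • x) y = a * s x y)
    (smul_right : ∀ (a : ℂ) x y, s x (a • y) = conj a * s x y)
    (diag : ∀ x, s x x = 0) (x y : V) : s x y = 0 := by
  have h1 := diag (x + y)
  have h2 := diag (x + Complex.I • y)
  simp only [add_left, add_right, smul_left, smul_right, diag, Complex.conj_I] at h1 h2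
  have h3 : s y x = -s x y := by linear_combination h1
  rw [h3] at h2
  have h4 : (-2 * Complex.I) * s x y = 0 := by linear_combination h2
  have h5 : (-2 * Complex.I) ≠ 0 := by simp
  exact (mul_eq_zero.1 h4).resolve_left h5

/-- A quartic form `B(x, ȳ, z, w̄)` with the symmetries of a Kähler curvature tensor vanishes if it
vanishes on the diagonal. -/
theorem kahler_quartic_eq_zero {B : V → V → V → V → ℂ}
    (add₁ : ∀ x x' y z w, B (x + x') y z w = B x y z w + B x' y z w)
    (smul₁ : ∀ (a : ℂ) x y z w, B (a • x) y z w = a * B x y z w)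
    (add₂ : ∀ x y y' z w, B x (y + y') z w = B x y z w + B x y' z w)
    (smul₂ : ∀ (a : ℂ) x y z w, B x (a • y) z w = conj a * B x y z w)
    (symm₁ : ∀ x y z w, B x y z w = B z y x w) (symm₂ : ∀ x y z w, B x y z w = B x w z y)
    (diag : ∀ x, B x x x x = 0) (x y z w : V) : B x y z w = 0 := by
  have add₃ : ∀ x y z z' w, B x y (z + z') w = B x y z w + B x y z' w := fun x y z z' w => by
    rw [symm₁, add₁, symm₁ z, symm₁ z']
  have smul₃ : ∀ (a : ℂ) x y z w, B x y (a • z) w = a * B x y z w := fun a x y z w => by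
    rw [symm₁, smul₁, symm₁ z]
  have add₄ : ∀ x y z w w', B x y z (w + w') = B x y z w + B x y z w' := fun x y z w w' => by
    rw [symm₂, add₂, symm₂ x w, symm₂ x w']
  have smul₄ : ∀ (a : ℂ) x y z w, B x y z (a • w) = conj a * B x y z w := fun a x y z w => by
    rw [symm₂, smul₂, symm₂ x w]
  have key : ∀ x y, B x x y y = 0 := by
    intro x y
    -- Averaging the diagonal over `x + ζy` with `ζ⁴ = 1` keeps only the terms with as many `y` in
    -- linear as in antilinear slots. Besides the two pure ones these are four mixed terms, all
    -- equal by symmetry, which explains the division by 16.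
    have h1 := diag (x + y)
    have h2 := diag (x + (-1 : ℂ) • y)
    have h3 := diag (x + Complex.I • y)
    have h4 := diag (x + (-Complex.I) • y)
    simp only [add₁, smul₁, add₂, smul₂, add₃, smul₃, add₄, smul₄, diag, map_neg, map_one,
      Complex.conj_I] at h1 h2 h3 h4
    have e1 := symm₁ x x y y
    have e2 := symm₂ x x y y
    have e3 := symm₂ y x x y
    have hI : Complex.I ^ 2 = -1 := Complex.I_sq
    linear_combination (h1 + h2 + h3 + h4) / 16 + (2 * e1 + e2 + e3) / 4
      + (B x x y y + B y x x y + B x y y x + B y y x x - B x y x y - B y x y x) / 8 * hI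
  have key2 : ∀ x x' y, B x x' y y = 0 := fun x x' y =>
    sesquilinear_eq_zero (s := fun x x' => B x x' y y) (fun _ _ _ => add₁ _ _ _ _ _)
      (fun _ _ _ => add₂ _ _ _ _ _) (fun _ _ _ => smul₁ _ _ _ _ _) (fun _ _ _ => smul₂ _ _ _ _ _)
      (fun x => key x y) x x'
  exact sesquilinear_eq_zero (s := fun z w => B x y z w) (fun _ _ _ => add₃ _ _ _ _ _)
      (fun _ _ _ => add₄ _ _ _ _ _) (fun _ _ _ => smul₃ _ _ _ _ _) (fun _ _ _ => smul₄ _ _ _ _ _)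
      (fun z => key2 x y z) z w

/-- The array version of `kahler_quartic_eq_zero`. -/
theorem kahler_array_eq_zero {T : Fin n → Fin n → Fin n → Fin n → ℂ}
    (symm₁ : ∀ i j k l, T i j k l = T k j i l) (symm₂ : ∀ i j k l, T i j k l = T i l k j)
    (diag : ∀ v : Cn n, ∑ i, ∑ j, ∑ k, ∑ l, T i j k l * v i * conj (v j) * v k * conj (v l) = 0)
    (i j k l : Fin n) : T i j k l = 0 := by
  have := kahler_quartic_eq_zero (V := Cn n)
    (B := fun x y z w => ∑ i, ∑ j, ∑ k, ∑ l, T i j k l * x i * conj (y j) * z k * conj (w l))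
    (fun x x' y z w => by simp [mul_add, add_mul, Finset.sum_add_distrib])
    (fun a x y z w => by
      simp only [Finset.mul_sum, PiLp.smul_apply, smul_eq_mul]
      congr! 4
      ring_nf)
    (fun x y y' z w => by simp [mul_add, add_mul, Finset.sum_add_distrib])
    (fun a x y z w => by
      simp only [Finset.mul_sum, PiLp.smul_apply, smul_eq_mul, map_mul]
      congr! 4
      ring_nf)
    (fun x y z w => by
      have : ∀ F : Fin n → Fin n → Fin n → Fin n → ℂ,
          ∑ i, ∑ j, ∑ k, ∑ l, F i j k l = ∑ i, ∑ j, ∑ k, ∑ l, F k j i l := fun F => by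
        rw [Finset.sum_comm]
        simp_rw [Finset.sum_comm (s := Finset.univ) (t := Finset.univ)
          (f := fun i k => ∑ l, F i _ k l)]
        rw [Finset.sum_comm]
      rw [this]
      refine Finset.sum_congr rfl fun i _ => Finset.sum_congr rfl fun j _ =>
        Finset.sum_congr rfl fun k _ => Finset.sum_congr rfl fun l _ => ?_
      rw [symm₁]
      ring)
    (fun x y z w => by
      refine Finset.sum_congr rfl fun i _ => ?_
      have : ∀ F : Fin n → Fin n → Fin n → ℂ,
          ∑ j, ∑ k, ∑ l, F j k l = ∑ j, ∑ k, ∑ l, F l k j := fun F => by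
        rw [Finset.sum_comm]
        simp_rw [Finset.sum_comm (s := Finset.univ) (t := Finset.univ) (f := fun i k => F i _ k)]
        rw [Finset.sum_comm]
      rw [this]
      refine Finset.sum_congr rfl fun j _ =>
        Finset.sum_congr rfl fun k _ => Finset.sum_congr rfl fun l _ => ?_
      rw [symm₂]
      ring)
    diag (EuclideanSpace.single i 1) (EuclideanSpace.single j 1) (EuclideanSpace.single k 1)
    (EuclideanSpace.single l 1)
  simpa [Pi.single_apply, apply_ite] using this

end Polarization

/-! ### Kähler metrics, their curvature tensor and the Chern connection. -/

section Metric

/-- Smoothness of the determinant. -/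
theorem contDiffOn_det {m : Type*} [Fintype m] [DecidableEq m] {M : Cn n → Matrix m m ℂ}
    (hM : ∀ i j, ContDiffOn ℝ ∞ (fun x => M x i j) U) : ContDiffOn ℝ ∞ (fun x => (M x).det) U := by
  simp only [Matrix.det_apply']
  exact ContDiffOn.sum fun σ _ => contDiffOn_const.mul (contDiffOn_prod fun i _ => hM _ _)

/-- Smoothness of the entries of the inverse matrix. -/
theorem contDiffOn_matrix_inv {m : Type*} [Fintype m] [DecidableEq m] {M : Cn n → Matrix m m ℂ}
    (hM : ∀ i j, ContDiffOn ℝ ∞ (fun x => M x i j) U) (h0 : ∀ x ∈ U, (M x).det ≠ 0) (i j : m) :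
    ContDiffOn ℝ ∞ (fun x => (M x)⁻¹ i j) U := by
  have hadj : ContDiffOn ℝ ∞ (fun x => (M x).adjugate i j) U := by
    simp only [Matrix.adjugate_apply]
    refine contDiffOn_det fun a b => ?_
    by_cases ha : a = j
    · subst ha
      simpa using contDiffOn_const
    · simpa [Matrix.updateRow_ne ha] using hM a b
  simp only [Matrix.inv_def, Ring.inverse_eq_inv', Matrix.smul_apply, smul_eq_mul]
  exact ((contDiffOn_det hM).inv h0).mul hadj

theorem metric_eq (φ : Cn n → ℝ) (i j : Fin n) : (fun w => metric φ w i j)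
    = wirt (Sum.inl i) (wirt (Sum.inr j) fun w => (φ w : ℂ)) := by
  rw [wirt_inl, wirt_inr]
  rfl

namespace IsKahlerPotentialOn

theorem contDiffOn_ofReal (hφ : IsKahlerPotentialOn φ U) :
    ContDiffOn ℝ ∞ (fun w => (φ w : ℂ)) U :=
  Complex.ofRealCLM.contDiff.comp_contDiffOn hφ.smooth

theorem det_ne_zero (hφ : IsKahlerPotentialOn φ U) (hz : z ∈ U) : (metric φ z).det ≠ 0 :=
  (hφ.posDef z hz).det_pos.ne'

theorem conj_metric (hφ : IsKahlerPotentialOn φ U) (hz : z ∈ U) (i j : Fin n) :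
    conj (metric φ z i j) = metric φ z j i :=
  (hφ.posDef z hz).isHermitian.apply j i

theorem contDiffOn_metric (hφ : IsKahlerPotentialOn φ U) (hU : IsOpen U) (i j : Fin n) :
    ContDiffOn ℝ ∞ (fun w => metric φ w i j) U := by
  rw [metric_eq]
  exact wirt_contDiffOn hU (wirt_contDiffOn hU hφ.contDiffOn_ofReal _) _

end IsKahlerPotentialOn

end Metric

/-- The Christoffel symbols `Γ_{j i}^l = ∑ (∂ⱼ g_{i q̄}) g^{q̄ l}`. -/
def christoffel (φ : Cn n → ℝ) (j i l : Fin n) (z : Cn n) : ℂ :=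
  ∑ q, wirt (Sum.inl j) (fun w => metric φ w i q) z * (metric φ z)⁻¹ q l

theorem riemann_eq (φ : Cn n → ℝ) (z : Cn n) (i j k l : Fin n) : riemann φ z i j k l
    = -wirt (Sum.inl k) (wirt (Sum.inr l) fun w => metric φ w i j) z
      + ∑ p, ∑ q, (metric φ z)⁻¹ q p * wirt (Sum.inr l) (fun w => metric φ w p j) z
        * wirt (Sum.inl k) (fun w => metric φ w i q) z := by
  simp only [wirt_inl, wirt_inr]
  rfl

theorem sum_swap_first_third {M : Type*} [AddCommMonoid M] (F : Fin n → Fin n → Fin n → M) :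
    ∑ j, ∑ k, ∑ l, F j k l = ∑ j, ∑ k, ∑ l, F l k j := by
  rw [Finset.sum_comm]
  simp_rw [Finset.sum_comm (s := Finset.univ) (t := Finset.univ) (f := fun i k => F i _ k)]
  rw [Finset.sum_comm]

namespace IsKahlerPotentialOn

theorem metric_eq_inr_inl (hφ : IsKahlerPotentialOn φ U) (hU : IsOpen U) (hz : z ∈ U)
    (i j : Fin n) : metric φ z i j
      = wirt (Sum.inr j) (wirt (Sum.inl i) fun w => (φ w : ℂ)) z := by
  rw [← wirt_comm hU hφ.contDiffOn_ofReal hz, ← metric_eq]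

/-- The Kähler condition: both sides are the same third derivative of the potential. The symmetries
of the curvature tensor come from this and its conjugate analogue. -/
theorem wirt_inl_metric_symm (hφ : IsKahlerPotentialOn φ U) (hU : IsOpen U) (hz : z ∈ U)
    (i j k : Fin n) : wirt (Sum.inl k) (fun w => metric φ w i j) z
      = wirt (Sum.inl i) (fun w => metric φ w k j) z := by
  rw [metric_eq, metric_eq, wirt_comm hU (wirt_contDiffOn hU hφ.contDiffOn_ofReal _) hz]

theorem wirt_inr_metric_symm (hφ : IsKahlerPotentialOn φ U) (hU : IsOpen U) (hz : z ∈ U)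
    (i j l : Fin n) : wirt (Sum.inr l) (fun w => metric φ w i j) z
      = wirt (Sum.inr j) (fun w => metric φ w i l) z := by
  rw [wirt_congr_on hU (fun w hw => hφ.metric_eq_inr_inl hU hw i j) hz,
    wirt_congr_on hU (fun w hw => hφ.metric_eq_inr_inl hU hw i l) hz,
    wirt_comm hU (wirt_contDiffOn hU hφ.contDiffOn_ofReal _) hz]

theorem riemann_symm_left (hφ : IsKahlerPotentialOn φ U) (hU : IsOpen U) (hz : z ∈ U)
    (i j k l : Fin n) : riemann φ z i j k l = riemann φ z k j i l := by
  rw [riemann_eq, riemann_eq, wirt_comm hU (hφ.contDiffOn_metric hU i j) hz,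
    wirt_congr_on hU (fun w hw => hφ.wirt_inl_metric_symm hU hw i j k) hz,
    wirt_comm hU (hφ.contDiffOn_metric hU k j) hz]
  simp only [fun q => hφ.wirt_inl_metric_symm hU hz i q k]

theorem riemann_symm_right (hφ : IsKahlerPotentialOn φ U) (hU : IsOpen U) (hz : z ∈ U)
    (i j k l : Fin n) : riemann φ z i j k l = riemann φ z i l k j := by
  rw [riemann_eq, riemann_eq,
    wirt_congr_on hU (fun w hw => hφ.wirt_inr_metric_symm hU hw i j l) hz]
  simp only [fun q => hφ.wirt_inr_metric_symm hU hz q j l]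

theorem metric_form_ne_zero (hφ : IsKahlerPotentialOn φ U) (hz : z ∈ U) {v : Cn n} (hv : v ≠ 0) :
    ∑ i, ∑ j, metric φ z i j * v i * conj (v j) ≠ 0 := by
  have hx : (fun i => conj (v i)) ≠ (0 : Fin n → ℂ) := by
    intro h
    apply hv
    ext i
    simpa using congrFun h i
  have := (hφ.posDef z hz).dotProduct_mulVec_pos hx
  refine ne_of_gt (this.trans_eq ?_)
  simp only [dotProduct, Matrix.mulVec, Finset.mul_sum, Pi.star_apply, RCLike.star_def,
    Complex.conj_conj]
  refine Finset.sum_congr rfl fun i _ => Finset.sum_congr rfl fun j _ => ?_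
  ring

/-- Constant holomorphic sectional curvature `2c` determines the curvature tensor. -/
theorem riemann_of_const (hφ : IsKahlerPotentialOn φ U) (hU : IsOpen U)
    (hκ : HasConstHolSectionalCurvatureOn φ (2 * c) U) (hz : z ∈ U) (i j k l : Fin n) :
    riemann φ z i j k l = c * (metric φ z i j * metric φ z k l + metric φ z i l * metric φ z k j) := by
  -- The difference has the symmetries of a Kähler curvature tensor, so it is enough to test the
  -- diagonal. There both metric terms equal `g(v, v̄)²`, which accounts for the factor 2 in `2c`.
  rw [← sub_eq_zero]
  refine kahler_array_eq_zero (T := fun i j k l => riemann φ z i j k l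
    - c * (metric φ z i j * metric φ z k l + metric φ z i l * metric φ z k j))
    (fun i j k l => by rw [hφ.riemann_symm_left hU hz]; ring)
    (fun i j k l => by rw [hφ.riemann_symm_right hU hz]; ring) (fun v => ?_) i j k l
  rcases eq_or_ne v 0 with rfl | hv
  · simp
  have h := hκ z hz v hv
  rw [holSectionalCurvature, div_eq_iff (pow_ne_zero 2 (hφ.metric_form_ne_zero hz hv))] at h
  have h1 : (∑ i, ∑ j, metric φ z i j * v i * conj (v j)) ^ 2 = ∑ i, ∑ j, ∑ k, ∑ l,
      metric φ z i j * metric φ z k l * v i * conj (v j) * v k * conj (v l) := by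
    rw [pow_two, Finset.sum_mul]
    refine Finset.sum_congr rfl fun i _ => ?_
    rw [Finset.sum_mul]
    refine Finset.sum_congr rfl fun j _ => ?_
    rw [Finset.mul_sum]
    refine Finset.sum_congr rfl fun k _ => ?_
    rw [Finset.mul_sum]
    refine Finset.sum_congr rfl fun l _ => ?_
    ring
  have h2 : ∑ i, ∑ j, ∑ k, ∑ l,
      metric φ z i l * metric φ z k j * v i * conj (v j) * v k * conj (v l)
      = (∑ i, ∑ j, metric φ z i j * v i * conj (v j)) ^ 2 := by
    rw [h1]
    refine Finset.sum_congr rfl fun i _ => ?_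
    rw [sum_swap_first_third]
    refine Finset.sum_congr rfl fun j _ => Finset.sum_congr rfl fun k _ =>
      Finset.sum_congr rfl fun l _ => ?_
    ring
  have h3 : ∑ i, ∑ j, ∑ k, ∑ l, (riemann φ z i j k l
      - c * (metric φ z i j * metric φ z k l + metric φ z i l * metric φ z k j))
        * v i * conj (v j) * v k * conj (v l)
      = (∑ i, ∑ j, ∑ k, ∑ l, riemann φ z i j k l * v i * conj (v j) * v k * conj (v l))
        - c * ((∑ i, ∑ j, ∑ k, ∑ l,
          metric φ z i j * metric φ z k l * v i * conj (v j) * v k * conj (v l))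
          + ∑ i, ∑ j, ∑ k, ∑ l,
            metric φ z i l * metric φ z k j * v i * conj (v j) * v k * conj (v l)) := by
    simp only [Finset.mul_sum, ← Finset.sum_sub_distrib, ← Finset.sum_add_distrib]
    refine Finset.sum_congr rfl fun i _ => Finset.sum_congr rfl fun j _ =>
      Finset.sum_congr rfl fun k _ => Finset.sum_congr rfl fun l _ => ?_
    ring
  rw [h3, ← h1, h2, h]
  push_cast
  ring

theorem contDiffOn_christoffel (hφ : IsKahlerPotentialOn φ U) (hU : IsOpen U) (j i l : Fin n) :
    ContDiffOn ℝ ∞ (christoffel φ j i l) U :=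
  ContDiffOn.sum fun q _ => (wirt_contDiffOn hU (hφ.contDiffOn_metric hU i q) _).mul
    (contDiffOn_matrix_inv (hφ.contDiffOn_metric hU) (fun _ hx => hφ.det_ne_zero hx) q l)

theorem christoffel_symm (hφ : IsKahlerPotentialOn φ U) (hU : IsOpen U) (hz : z ∈ U)
    (j i l : Fin n) : christoffel φ j i l z = christoffel φ i j l z := by
  simp only [christoffel, fun q => hφ.wirt_inl_metric_symm hU hz i q j]

theorem sum_christoffel_mul_metric (hφ : IsKahlerPotentialOn φ U) (hz : z ∈ U)
    (j i m : Fin n) : ∑ l, christoffel φ j i l z * metric φ z l m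
      = wirt (Sum.inl j) (fun w => metric φ w i m) z := by
  have h : (metric φ z)⁻¹ * metric φ z = 1 :=
    Matrix.nonsing_inv_mul _ (isUnit_iff_ne_zero.2 (hφ.det_ne_zero hz))
  have h' : ∀ q, ∑ l, (metric φ z)⁻¹ q l * metric φ z l m = if q = m then 1 else 0 := fun q => by
    rw [← Matrix.mul_apply, h, Matrix.one_apply]
  simp only [christoffel, Finset.sum_mul]
  rw [Finset.sum_comm]
  simp only [mul_assoc, ← Finset.mul_sum, h']
  simp

theorem eq_of_sum_mul_metric_eq (hφ : IsKahlerPotentialOn φ U) (hz : z ∈ U) {X Y : Fin n → ℂ}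
    (h : ∀ m, ∑ l, X l * metric φ z l m = ∑ l, Y l * metric φ z l m) : X = Y := by
  have h1 : Matrix.vecMul X (metric φ z) = Matrix.vecMul Y (metric φ z) := funext h
  have h2 : metric φ z * (metric φ z)⁻¹ = 1 :=
    Matrix.mul_nonsing_inv _ (isUnit_iff_ne_zero.2 (hφ.det_ne_zero hz))
  have := congrArg (fun v => Matrix.vecMul v (metric φ z)⁻¹) h1
  simpa [Matrix.vecMul_vecMul, h2] using this

/-- Obtained by differentiating `∑ Γ_{ji}^l g_{l m̄} = ∂ⱼ g_{i m̄}`; with the upper index lowered,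
the inverse metric never has to be differentiated. -/
theorem sum_wirt_christoffel_mul_metric (hφ : IsKahlerPotentialOn φ U) (hU : IsOpen U)
    (hz : z ∈ U) (d : Fin n ⊕ Fin n) (j i m : Fin n) :
    ∑ l, wirt d (christoffel φ j i l) z * metric φ z l m
      = wirt d (wirt (Sum.inl j) fun w => metric φ w i m) z
        - ∑ l, christoffel φ j i l z * wirt d (fun w => metric φ w l m) z := by
  have hΓ : ∀ l, DifferentiableAt ℝ (christoffel φ j i l) z := fun l =>
    ((hφ.contDiffOn_christoffel hU j i l).contDiffAt (hU.mem_nhds hz)).differentiableAt (by simp)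
  have hg : ∀ l, DifferentiableAt ℝ (fun w => metric φ w l m) z := fun l =>
    ((hφ.contDiffOn_metric hU l m).contDiffAt (hU.mem_nhds hz)).differentiableAt (by simp)
  rw [← wirt_congr_on hU (fun w hw => hφ.sum_christoffel_mul_metric hw j i m) hz,
    wirt_sum (F := fun l w => christoffel φ j i l w * metric φ w l m) _ _
      fun l _ => (hΓ l).mul (hg l), eq_sub_iff_add_eq, ← Finset.sum_add_distrib]
  exact Finset.sum_congr rfl fun l _ => (wirt_mul d (hΓ l) (hg l)).symm

/-- The `(2,0)`-part of the curvature of the Chern connection vanishes. -/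
theorem wirt_inl_christoffel_symm (hφ : IsKahlerPotentialOn φ U) (hU : IsOpen U) (hz : z ∈ U)
    (k j i m : Fin n) :
    wirt (Sum.inl k) (christoffel φ j i m) z + ∑ l, christoffel φ j i l z * christoffel φ k l m z
      = wirt (Sum.inl j) (christoffel φ k i m) z
        + ∑ l, christoffel φ k i l z * christoffel φ j l m z := by
  -- After lowering the index, each side is a pure second derivative `∂ₖ∂ⱼ g_{i m̄}`, which is
  -- symmetric in `j, k`.
  have key : ∀ k j m, ∑ a, (wirt (Sum.inl k) (christoffel φ j i a) z
      + ∑ l, christoffel φ j i l z * christoffel φ k l a z) * metric φ z a m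
      = wirt (Sum.inl k) (wirt (Sum.inl j) fun w => metric φ w i m) z := by
    intro k j m
    simp only [add_mul, Finset.sum_add_distrib, Finset.sum_mul]
    rw [hφ.sum_wirt_christoffel_mul_metric hU hz, Finset.sum_comm]
    simp only [mul_assoc, ← Finset.mul_sum, hφ.sum_christoffel_mul_metric hz]
    ring
  refine congrFun (hφ.eq_of_sum_mul_metric_eq hz
    (X := fun m => wirt (Sum.inl k) (christoffel φ j i m) z
      + ∑ l, christoffel φ j i l z * christoffel φ k l m z)
    (Y := fun m => wirt (Sum.inl j) (christoffel φ k i m) z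
      + ∑ l, christoffel φ k i l z * christoffel φ j l m z) fun m => ?_) m
  rw [key, key, wirt_comm hU (hφ.contDiffOn_metric hU i m) hz]

/-- The `(1,1)`-part of the curvature of the Chern connection in constant holomorphic sectional
curvature `2c`. -/
theorem wirt_inr_christoffel (hφ : IsKahlerPotentialOn φ U) (hU : IsOpen U)
    (hκ : HasConstHolSectionalCurvatureOn φ (2 * c) U) (hz : z ∈ U) (k j i m : Fin n) :
    wirt (Sum.inr k) (christoffel φ j i m) z
      = -c * (metric φ z j k * (if i = m then 1 else 0)
        + metric φ z i k * (if j = m then 1 else 0)) := by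
  refine congrFun (hφ.eq_of_sum_mul_metric_eq hz
    (X := fun m => wirt (Sum.inr k) (christoffel φ j i m) z)
    (Y := fun m => -c * (metric φ z j k * (if i = m then 1 else 0)
        + metric φ z i k * (if j = m then 1 else 0))) fun a => ?_) m
  -- Lowering the upper index of `∂_{k̄} Γ_{ji}^m` produces exactly `-R_{i ā j k̄}`.
  have hR := hφ.riemann_of_const hU hκ hz i a j k
  rw [riemann_eq, wirt_comm hU (hφ.contDiffOn_metric hU i a) hz] at hR
  have h1 : ∑ l, christoffel φ j i l z * wirt (Sum.inr k) (fun w => metric φ w l a) z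
      = ∑ p, ∑ q, (metric φ z)⁻¹ q p * wirt (Sum.inr k) (fun w => metric φ w p a) z
        * wirt (Sum.inl j) (fun w => metric φ w i q) z := by
    simp only [christoffel, Finset.sum_mul]
    refine Finset.sum_congr rfl fun p _ => Finset.sum_congr rfl fun q _ => ?_
    ring
  rw [hφ.sum_wirt_christoffel_mul_metric hU hz, h1]
  have h2 : ∑ l, -c * (metric φ z j k * (if i = l then 1 else 0)
      + metric φ z i k * (if j = l then 1 else 0)) * metric φ z l a
      = -c * (metric φ z i a * metric φ z j k + metric φ z i k * metric φ z j a) := by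
    simp only [mul_add, add_mul, Finset.sum_add_distrib, mul_ite, ite_mul, mul_one, mul_zero,
      zero_mul, Finset.sum_ite_eq, Finset.mem_univ, if_true]
    ring
  rw [h2]
  linear_combination -hR

end IsKahlerPotentialOn

/-! ### The flat connection on pairs `(h, α)` and its parallel Hermitian form. -/

/-- Coefficients of the linear system `∂ᵢ h = αᵢ + c φᵢ h`, `∂_{ī} h = 0`,
`∂ⱼ αᵢ = ∑ Γ_{ji}^l αₗ + c φⱼ αᵢ`, `∂_{j̄} αᵢ = -c g_{i j̄} h` for `(h, α)`. -/
def tractor (φ : Cn n → ℝ) (c : ℝ) :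
    Fin n ⊕ Fin n → Option (Fin n) → Option (Fin n) → Cn n → ℂ
  | .inl j, none, none => fun x => c * wirt (Sum.inl j) (fun w => (φ w : ℂ)) x
  | .inl j, none, some l => fun _ => if j = l then 1 else 0
  | .inl _, some _, none => fun _ => 0
  | .inl j, some i, some l => fun x => christoffel φ j i l x
      + (if i = l then 1 else 0) * (c * wirt (Sum.inl j) (fun w => (φ w : ℂ)) x)
  | .inr _, none, _ => fun _ => 0
  | .inr j, some i, none => fun x => -c * metric φ x i j
  | .inr _, some _, some _ => fun _ => 0

/-- The Hermitian form `e^{cφ} diag(1, c g)` which is parallel for `tractor φ c`. -/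
def tractorForm (φ : Cn n → ℝ) (c : ℝ) : Option (Fin n) → Option (Fin n) → Cn n → ℂ
  | none, none => fun x => Complex.exp (c * φ x)
  | none, some _ => fun _ => 0
  | some _, none => fun _ => 0
  | some i, some j => fun x => Complex.exp (c * φ x) * (c * metric φ x i j)

namespace IsKahlerPotentialOn

theorem contDiffOn_tractor (hφ : IsKahlerPotentialOn φ U) (hU : IsOpen U) (d : Fin n ⊕ Fin n)
    (a b : Option (Fin n)) : ContDiffOn ℝ ∞ (tractor φ c d a b) U := by
  have h1 : ∀ j, ContDiffOn ℝ ∞ (wirt (Sum.inl j) (fun w => (φ w : ℂ))) U := fun j =>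
    wirt_contDiffOn hU hφ.contDiffOn_ofReal _
  rcases d with j | j <;> rcases a with _ | i <;> rcases b with _ | l
  · exact contDiffOn_const.mul (h1 j)
  · exact contDiffOn_const
  · exact contDiffOn_const
  · exact (hφ.contDiffOn_christoffel hU j i l).add
      (contDiffOn_const.mul (contDiffOn_const.mul (h1 j)))
  · exact contDiffOn_const
  · exact contDiffOn_const
  · exact contDiffOn_const.mul (hφ.contDiffOn_metric hU i j)
  · exact contDiffOn_const

/-- No curvature hypothesis enters: the blocks reduce to `∂ₖφⱼ = ∂ⱼφₖ`, the symmetry of `Γ` in its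
lower indices, and the vanishing `(2,0)`-curvature of the Chern connection. -/
theorem tractor_flat_inl_inl (hφ : IsKahlerPotentialOn φ U) (hU : IsOpen U) (hz : z ∈ U)
    (j k : Fin n) (a b : Option (Fin n)) :
    wirt (Sum.inl k) (tractor φ c (Sum.inl j) a b) z
        + ∑ e, tractor φ c (Sum.inl j) a e z * tractor φ c (Sum.inl k) e b z
      = wirt (Sum.inl j) (tractor φ c (Sum.inl k) a b) z
        + ∑ e, tractor φ c (Sum.inl k) a e z * tractor φ c (Sum.inl j) e b z := by
  have hΦ := hφ.contDiffOn_ofReal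
  have d1 : ∀ j, DifferentiableAt ℝ (wirt (Sum.inl j) (fun w => (φ w : ℂ))) z := fun j =>
    ((wirt_contDiffOn hU hΦ _).contDiffAt (hU.mem_nhds hz)).differentiableAt (by simp)
  have dΓ : ∀ j i l, DifferentiableAt ℝ (christoffel φ j i l) z := fun j i l =>
    ((hφ.contDiffOn_christoffel hU j i l).contDiffAt (hU.mem_nhds hz)).differentiableAt (by simp)
  have hcomm := wirt_comm hU hΦ hz (Sum.inl j) (Sum.inl k)
  rcases a with _ | i <;> rcases b with _ | m <;> rw [Fintype.sum_option, Fintype.sum_option] <;>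
    simp only [tractor, wirt_const]
  · rw [wirt_const_mul _ _ (d1 j), wirt_const_mul _ _ (d1 k), hcomm]
    simp
    ring
  · simp only [ite_mul, one_mul, zero_mul, Finset.sum_ite_eq, Finset.mem_univ, if_true,
      hφ.christoffel_symm hU hz k j]
    simp only [mul_ite, mul_one, mul_zero]
    ring
  · simp
  · rw [wirt_add _ (dΓ j i m) (((d1 j).const_mul _).const_mul _),
      wirt_add _ (dΓ k i m) (((d1 k).const_mul _).const_mul _),
      wirt_const_mul _ _ ((d1 j).const_mul _), wirt_const_mul _ _ ((d1 k).const_mul _),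
      wirt_const_mul _ _ (d1 j), wirt_const_mul _ _ (d1 k), hcomm]
    have h := hφ.wirt_inl_christoffel_symm hU hz k j i m
    simp only [add_mul, mul_add, Finset.sum_add_distrib, ite_mul, mul_ite, one_mul, zero_mul,
      mul_zero, mul_one, Finset.sum_ite_eq, Finset.sum_ite_eq', Finset.mem_univ, if_true]
    split_ifs <;> linear_combination h

/-- The only integrability condition that uses the curvature. Its `α`-`α` block is `∂_{k̄} Γ_{ji}^m
+ c g_{j k̄} δ_{im} = -c g_{i k̄} δ_{jm}`, which is the constant curvature equation; the other
blocks hold for any Kähler potential. -/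
theorem tractor_flat_inl_inr (hφ : IsKahlerPotentialOn φ U) (hU : IsOpen U)
    (hκ : HasConstHolSectionalCurvatureOn φ (2 * c) U) (hz : z ∈ U)
    (j k : Fin n) (a b : Option (Fin n)) :
    wirt (Sum.inr k) (tractor φ c (Sum.inl j) a b) z
        + ∑ e, tractor φ c (Sum.inl j) a e z * tractor φ c (Sum.inr k) e b z
      = wirt (Sum.inl j) (tractor φ c (Sum.inr k) a b) z
        + ∑ e, tractor φ c (Sum.inr k) a e z * tractor φ c (Sum.inl j) e b z := by
  have hΦ := hφ.contDiffOn_ofReal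
  have d1 : ∀ j, DifferentiableAt ℝ (wirt (Sum.inl j) (fun w => (φ w : ℂ))) z := fun j =>
    ((wirt_contDiffOn hU hΦ _).contDiffAt (hU.mem_nhds hz)).differentiableAt (by simp)
  have dΓ : ∀ j i l, DifferentiableAt ℝ (christoffel φ j i l) z := fun j i l =>
    ((hφ.contDiffOn_christoffel hU j i l).contDiffAt (hU.mem_nhds hz)).differentiableAt (by simp)
  have dg : ∀ i j, DifferentiableAt ℝ (fun w => metric φ w i j) z := fun i j =>
    ((hφ.contDiffOn_metric hU i j).contDiffAt (hU.mem_nhds hz)).differentiableAt (by simp)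
  have hg := hφ.metric_eq_inr_inl hU hz j k
  rcases a with _ | i <;> rcases b with _ | m <;> rw [Fintype.sum_option, Fintype.sum_option] <;>
    simp only [tractor, wirt_const]
  · rw [wirt_const_mul _ _ (d1 j), ← hg]
    simp
  · simp
  · rw [wirt_const_mul _ _ (dg i k)]
    have h := hφ.sum_christoffel_mul_metric hz j i k
    have h' : ∀ l, (christoffel φ j i l z + (if i = l then 1 else 0)
        * (c * wirt (Sum.inl j) (fun w => (φ w : ℂ)) z)) * (-c * metric φ z l k)
        = -c * (christoffel φ j i l z * metric φ z l k) + (if i = l then 1 else 0)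
          * ((c * wirt (Sum.inl j) (fun w => (φ w : ℂ)) z) * (-c * metric φ z l k)) := fun l => by
      ring
    simp only [h', Finset.sum_add_distrib, ← Finset.mul_sum, h]
    simp
    ring
  · rw [wirt_add _ (dΓ j i m) (((d1 j).const_mul _).const_mul _),
      wirt_const_mul _ _ ((d1 j).const_mul _), wirt_const_mul _ _ (d1 j), ← hg,
      hφ.wirt_inr_christoffel hU hκ hz]
    simp only [mul_zero, zero_mul, Finset.sum_const_zero]
    ring

/-- The `∂_{j̄}` coefficients only send `h` to `α`, so their products vanish, and what remains is
the Kähler symmetry of `∂_{k̄} g_{i j̄}`. -/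
theorem tractor_flat_inr_inr (hφ : IsKahlerPotentialOn φ U) (hU : IsOpen U) (hz : z ∈ U)
    (j k : Fin n) (a b : Option (Fin n)) :
    wirt (Sum.inr k) (tractor φ c (Sum.inr j) a b) z
        + ∑ e, tractor φ c (Sum.inr j) a e z * tractor φ c (Sum.inr k) e b z
      = wirt (Sum.inr j) (tractor φ c (Sum.inr k) a b) z
        + ∑ e, tractor φ c (Sum.inr k) a e z * tractor φ c (Sum.inr j) e b z := by
  have dg : ∀ i j, DifferentiableAt ℝ (fun w => metric φ w i j) z := fun i j =>
    ((hφ.contDiffOn_metric hU i j).contDiffAt (hU.mem_nhds hz)).differentiableAt (by simp)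
  rcases a with _ | i <;> rcases b with _ | m <;> rw [Fintype.sum_option, Fintype.sum_option] <;>
    simp only [tractor, wirt_const]
  · simp
  · rw [wirt_const_mul _ _ (dg i j), wirt_const_mul _ _ (dg i k),
      hφ.wirt_inr_metric_symm hU hz]
    simp
  · simp

/-- In constant holomorphic sectional curvature `2c` the system `tractor φ c` is flat. -/
theorem tractor_flat (hφ : IsKahlerPotentialOn φ U) (hU : IsOpen U)
    (hκ : HasConstHolSectionalCurvatureOn φ (2 * c) U) (hz : z ∈ U)
    (d e : Fin n ⊕ Fin n) (a b : Option (Fin n)) :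
    wirt e (tractor φ c d a b) z + ∑ k, tractor φ c d a k z * tractor φ c e k b z
      = wirt d (tractor φ c e a b) z + ∑ k, tractor φ c e a k z * tractor φ c d k b z := by
  rcases d with j | j <;> rcases e with k | k
  · exact hφ.tractor_flat_inl_inl hU hz j k a b
  · exact hφ.tractor_flat_inl_inr hU hκ hz j k a b
  · exact (hφ.tractor_flat_inl_inr hU hκ hz k j a b).symm
  · exact hφ.tractor_flat_inr_inr hU hz j k a b

theorem contDiffOn_tractorForm (hφ : IsKahlerPotentialOn φ U) (hU : IsOpen U)
    (a b : Option (Fin n)) : ContDiffOn ℝ ∞ (tractorForm φ c a b) U := by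
  have he : ContDiffOn ℝ ∞ (fun x => Complex.exp (c * φ x)) U :=
    (contDiffOn_const.mul hφ.contDiffOn_ofReal).cexp
  rcases a with _ | i <;> rcases b with _ | j
  · exact he
  · exact contDiffOn_const
  · exact contDiffOn_const
  · exact he.mul (contDiffOn_const.mul (hφ.contDiffOn_metric hU i j))

theorem conj_tractorForm (hφ : IsKahlerPotentialOn φ U) (hz : z ∈ U) (a b : Option (Fin n)) :
    conj (tractorForm φ c a b z) = tractorForm φ c b a z := by
  rcases a with _ | i <;> rcases b with _ | j <;>
    simp [tractorForm, ← Complex.exp_conj, hφ.conj_metric hz]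

/-- The equation is the one satisfied by `s_a conj(s_b)` for solutions `s`; conjugation exchanges
`∂` and `∂̄`, hence the swapped direction in the second sum. The mixed entries vanish because
`δ_{jl}` paired with `c g` cancels `-c g`; the `α`-`α` entry is metric compatibility of `Γ`. -/
theorem wirt_inl_tractorForm (hφ : IsKahlerPotentialOn φ U) (hU : IsOpen U) (hz : z ∈ U)
    (j : Fin n) (a b : Option (Fin n)) : wirt (Sum.inl j) (tractorForm φ c a b) z
      = ∑ k, tractor φ c (Sum.inl j) a k z * tractorForm φ c k b z
        + ∑ k, conj (tractor φ c (Sum.inr j) b k z) * tractorForm φ c a k z := by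
  have dΦ : DifferentiableAt ℝ (fun w => (φ w : ℂ)) z :=
    (hφ.contDiffOn_ofReal.contDiffAt (hU.mem_nhds hz)).differentiableAt (by simp)
  have dg : ∀ i j, DifferentiableAt ℝ (fun w => metric φ w i j) z := fun i j =>
    ((hφ.contDiffOn_metric hU i j).contDiffAt (hU.mem_nhds hz)).differentiableAt (by simp)
  have de : DifferentiableAt ℝ (fun x => Complex.exp (c * φ x)) z := (dΦ.const_mul _).cexp
  have he : wirt (Sum.inl j) (fun x => Complex.exp (c * φ x)) z
      = Complex.exp (c * φ z) * (c * wirt (Sum.inl j) (fun w => (φ w : ℂ)) z) := by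
    rw [wirt_comp (F := Complex.exp) _ (Complex.hasDerivAt_exp _) (dΦ.const_mul _),
      wirt_const_mul _ _ dΦ]
  rcases a with _ | i <;> rcases b with _ | m <;> rw [Fintype.sum_option, Fintype.sum_option] <;>
    simp only [tractor, tractorForm, wirt_const]
  · rw [he]
    simp
    ring
  · simp [hφ.conj_metric hz]
    ring
  · simp
  · rw [wirt_mul _ de ((dg i m).const_mul _), he, wirt_const_mul _ _ (dg i m),
      ← hφ.sum_christoffel_mul_metric hz]
    simp only [add_mul, Finset.sum_add_distrib, ite_mul, one_mul, zero_mul, Finset.sum_ite_eq,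
      Finset.mem_univ, if_true, mul_zero, map_zero, Finset.sum_const_zero, Finset.mul_sum]
    simp only [zero_add, add_zero]
    rw [add_comm]
    congr 1
    · refine Finset.sum_congr rfl fun l _ => ?_
      ring
    · ring

/-- The form is Hermitian, so the `∂̄` equations are the conjugates of the `∂` equations with the
indices exchanged. -/
theorem wirt_tractorForm (hφ : IsKahlerPotentialOn φ U) (hU : IsOpen U) (hz : z ∈ U)
    (d : Fin n ⊕ Fin n) (a b : Option (Fin n)) : wirt d (tractorForm φ c a b) z
      = ∑ k, tractor φ c d a k z * tractorForm φ c k b z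
        + ∑ k, conj (tractor φ c d.swap b k z) * tractorForm φ c a k z := by
  rcases d with j | j
  · exact hφ.wirt_inl_tractorForm hU hz j a b
  · have dN : DifferentiableAt ℝ (tractorForm φ c b a) z :=
      ((hφ.contDiffOn_tractorForm hU b a).contDiffAt (hU.mem_nhds hz)).differentiableAt (by simp)
    rw [wirt_congr_on hU (fun w hw => (hφ.conj_tractorForm hw b a).symm) hz, wirt_conj _ dN,
      Sum.swap_inr, hφ.wirt_inl_tractorForm hU hz, map_add, map_sum, map_sum]
    simp only [map_mul, hφ.conj_tractorForm hz, Complex.conj_conj]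
    rw [add_comm]

end IsKahlerPotentialOn

/-! ### Uniqueness of parallel forms, and logarithms of holomorphic functions. -/

/-- Uniqueness for the linear system satisfied by sesquilinear expressions in solutions. -/
theorem exists_ball_hermitian_eq_zero {ι : Type*} [Fintype ι]
    {P : Fin n ⊕ Fin n → ι → ι → Cn n → ℂ} {p : Cn n} (hP : ∀ d a b, ContinuousAt (P d a b) p) :
    ∃ r > 0, ∀ r' ≤ r, ∀ D : ι → ι → Cn n → ℂ,
      (∀ x ∈ ball p r', ∀ a b, DifferentiableAt ℝ (D a b) x ∧ ∀ d, wirt d (D a b) x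
        = ∑ k, P d a k x * D k b x + ∑ k, conj (P d.swap b k x) * D a k x) →
      (∀ a b, D a b p = 0) → ∀ x ∈ ball p r', ∀ a b, D a b x = 0 := by
  have hc : ContinuousAt (fun x d a b => P d a b x) p :=
    continuousAt_pi.2 fun d => continuousAt_pi.2 fun a => continuousAt_pi.2 fun b => hP d a b
  set C := ‖fun d a b => P d a b p‖ + 1 with hC
  have hC0 : 0 ≤ C := by positivity
  have hev : ∀ᶠ x in 𝓝 p, ‖fun d a b => P d a b x‖ < C :=
    hc.norm.eventually_lt_const (by simp [hC])
  obtain ⟨r, hr, H⟩ := Metric.eventually_nhds_iff_ball.1 hev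
  refine ⟨r, hr, fun r' hr' D hD h0 x hx a b => ?_⟩
  -- Each coefficient is at most `C` near `p`; `K` adds the two sums over `k` for every Wirtinger
  -- direction, and the uniqueness then follows from Gronwall on rays.
  set K : ℝ := ∑ _d : Fin n ⊕ Fin n, (∑ _k : ι, C + ∑ _k : ι, C) with hK
  have hK0 : 0 ≤ K := by positivity
  have := eq_zero_on_ball_of_norm_fderiv_le (D := fun x a b => D a b x) (p := p) (r := r')
    (D' := fun x => ContinuousLinearMap.pi fun a => ContinuousLinearMap.pi fun b =>
      fderiv ℝ (D a b) x) (K := K)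
    (fun x hx => hasFDerivAt_pi.2 fun a => hasFDerivAt_pi.2 fun b =>
      ((hD x hx a b).1).hasFDerivAt) (fun x hx => ?_) (by funext a b; exact h0 a b) x hx
  · exact congrFun (congrFun this a) b
  have hPx : ∀ d a b, ‖P d a b x‖ ≤ C := fun d a b =>
    ((norm_le_pi_norm (fun b => P d a b x) b).trans
      ((norm_le_pi_norm (fun a b => P d a b x) a).trans
        (norm_le_pi_norm (fun d a b => P d a b x) d))).trans (H x (ball_subset_ball hr' hx)).le
  have hDx : ∀ a b, ‖D a b x‖ ≤ ‖fun a b => D a b x‖ := fun a b =>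
    (norm_le_pi_norm (fun b => D a b x) b).trans (norm_le_pi_norm (fun a b => D a b x) a)
  refine ContinuousLinearMap.opNorm_le_bound _ (by positivity) fun v => ?_
  have hθ : ∀ d, ‖coframe d v‖ ≤ ‖v‖ := by
    rintro (i | i)
    · exact PiLp.norm_apply_le v i
    · rw [coframe_inr, RCLike.norm_conj]
      exact PiLp.norm_apply_le v i
  refine (pi_norm_le_iff_of_nonneg (by positivity)).2 fun a =>
    (pi_norm_le_iff_of_nonneg (by positivity)).2 fun b => ?_
  change ‖fderiv ℝ (D a b) x v‖ ≤ _
  rw [sum_coframe_mul_wirtL (fderiv ℝ (D a b) x) v, hK, Finset.sum_mul, Finset.sum_mul]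
  refine norm_sum_le_of_le _ fun d _ => ?_
  have h1 : wirtL d (fderiv ℝ (D a b) x) = _ := (hD x hx a b).2 d
  rw [h1, norm_mul, mul_comm]
  refine mul_le_mul ?_ (hθ d) (norm_nonneg _) (by positivity)
  rw [add_mul, Finset.sum_mul]
  refine norm_add_le_of_le (norm_sum_le_of_le _ fun k _ => ?_)
    (norm_sum_le_of_le _ fun k _ => ?_) <;> rw [norm_mul] <;>
    refine mul_le_mul ?_ (hDx _ _) (norm_nonneg _) hC0
  · exact hPx _ _ _
  · rw [RCLike.norm_conj]
    exact hPx _ _ _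

theorem differentiableAt_conj {f : Cn n → ℂ} (hf : DifferentiableAt ℝ f z) :
    DifferentiableAt ℝ (fun w => conj (f w)) z :=
  (Complex.conjCLE : ℂ →L[ℝ] ℂ).differentiableAt.comp z hf

theorem differentiableAt_div {f g : Cn n → ℂ} (hf : DifferentiableAt ℝ f z)
    (hg : DifferentiableAt ℝ g z) (h0 : g z ≠ 0) : DifferentiableAt ℝ (fun w => f w / g w) z := by
  simp only [div_eq_mul_inv]
  exact hf.mul (hg.fun_inv h0)

theorem wirt_div {f g : Cn n → ℂ} (d : Fin n ⊕ Fin n) (hf : DifferentiableAt ℝ f z)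
    (hg : DifferentiableAt ℝ g z) (h0 : g z ≠ 0) :
    wirt d (fun w => f w / g w) z = (wirt d f z * g z - f z * wirt d g z) / g z ^ 2 := by
  simp only [div_eq_mul_inv]
  rw [wirt_mul d hf (hg.fun_inv h0), wirt_comp d (hasDerivAt_inv h0) hg]
  field_simp
  ring

/-- For holomorphic `h` one of the two terms vanishes in each direction; this is how
pluriharmonicity of `log |h|²` enters. -/
theorem wirt_log_norm_sq {h : Cn n → ℂ} (d : Fin n ⊕ Fin n) (hh : DifferentiableAt ℝ h z)
    (h0 : h z ≠ 0) : wirt d (fun w => ((Real.log (‖h w‖ ^ 2) : ℝ) : ℂ)) z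
      = wirt d h z / h z + conj (wirt d.swap h z / h z) := by
  have e : (fun w => ((Real.log (‖h w‖ ^ 2) : ℝ) : ℂ)) = fun w => Complex.log (h w * conj (h w)) := by
    funext w
    rw [Complex.ofReal_log (by positivity), Complex.mul_conj, Complex.normSq_eq_norm_sq]
  have hs : h z * conj (h z) ∈ Complex.slitPlane := by
    rw [Complex.mul_conj, Complex.ofReal_mem_slitPlane]
    exact Complex.normSq_pos.2 h0
  have h0' : conj (h z) ≠ 0 := by simpa using h0
  rw [e, wirt_comp (F := Complex.log) (f := fun w => h w * conj (h w)) d (Complex.hasDerivAt_log hs)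
    (hh.mul (differentiableAt_conj hh)), wirt_mul d hh (differentiableAt_conj hh), wirt_conj d hh,
    map_div₀]
  field_simp

/-- Real-valued functions have conjugate Wirtinger derivatives. -/
theorem IsKahlerPotentialOn.wirt_inr_ofReal (hφ : IsKahlerPotentialOn φ U) (hU : IsOpen U)
    (hz : z ∈ U) (j : Fin n) : wirt (Sum.inr j) (fun w => (φ w : ℂ)) z
      = conj (wirt (Sum.inl j) (fun w => (φ w : ℂ)) z) := by
  have dΦ : DifferentiableAt ℝ (fun w => (φ w : ℂ)) z :=
    (hφ.contDiffOn_ofReal.contDiffAt (hU.mem_nhds hz)).differentiableAt (by simp)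
  have := wirt_conj (Sum.inr j) dΦ
  simpa only [Complex.conj_ofReal, Sum.swap_inr] using this

open scoped MatrixOrder Matrix.Norms.L2Operator in
theorem exists_eq_conjTranspose_mul_self {m : Type*} [Fintype m] [DecidableEq m]
    {A : Matrix m m ℂ} (hA : A.PosSemidef) : ∃ B : Matrix m m ℂ, A = B.conjTranspose * B :=
  CStarAlgebra.nonneg_iff_eq_star_mul_self.mp hA.nonneg

/-! ### Normalized solutions and the holomorphic coordinates. -/

/-- The signs of the model Hermitian form `|h₀|² + c ∑ |hₘ|²`. -/
def modelSign (n : ℕ) (c : ℝ) : Option (Fin n) → ℂ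
  | none => 1
  | some _ => c

/-- Solutions of the flat system normalised at `p`: they represent `e^{cφ}` as
`|h₀|² + c ∑ |hₘ|²`. -/
theorem IsKahlerPotentialOn.exists_normalized_sections (hφ : IsKahlerPotentialOn φ U)
    (hU : IsOpen U) (hκ : HasConstHolSectionalCurvatureOn φ (2 * c) U) {p : Cn n} (hp : p ∈ U) :
    ∃ r > 0, ball p r ⊆ U ∧ ∃ s : Option (Fin n) → Option (Fin n) → Cn n → ℂ,
      (∀ m, ∀ x ∈ ball p r, ∀ a, DifferentiableAt ℝ (s m a) x ∧
        ∀ d, wirt d (s m a) x = ∑ b, tractor φ c d a b x * s m b x) ∧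
      (∀ x ∈ ball p r, Complex.exp (c * φ x)
        = ∑ m, modelSign n c m * (s m none x * conj (s m none x))) ∧
      s none none p ≠ 0 ∧ (∀ i, s none (some i) p = 0) ∧ (∀ m, s (some m) none p = 0) ∧
      (Matrix.of fun m i => s (some m) (some i) p).det ≠ 0 := by
  obtain ⟨r₁, hr₁, hball, hs⟩ := exists_flat_sections hU (hφ.contDiffOn_tractor (c := c) hU)
    (fun x hx d e a b => hφ.tractor_flat hU hκ hx d e a b) hp
  obtain ⟨r₂, hr₂, huniq⟩ := exists_ball_hermitian_eq_zero (P := tractor φ c) (p := p)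
    fun d a b => ((hφ.contDiffOn_tractor hU d a b).contDiffAt (hU.mem_nhds hp)).continuousAt
  obtain ⟨B, hB⟩ := exists_eq_conjTranspose_mul_self (hφ.posDef p hp).posSemidef
  have hBdet : B.det ≠ 0 := by
    have h1 := hφ.det_ne_zero hp
    rw [hB, Matrix.det_mul] at h1
    exact right_ne_zero_of_mul h1
  set e : ℂ := Complex.exp (c * φ p / 2) with he
  have he0 : e ≠ 0 := Complex.exp_ne_zero _
  have hee : e * conj e = Complex.exp (c * φ p) := by
    rw [he, ← Complex.exp_conj, ← Complex.exp_add]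
    congr 1
    simp [Complex.conj_ofNat]
  -- Initial values diagonalizing the parallel form at `p`: with `g(p) = B* B` and `|e|² =
  -- e^{cφ(p)}`, the weighted sum of the `W m a * conj (W m b)` is `e^{cφ} diag(1, c g)` at `p`.
  let W : Option (Fin n) → Option (Fin n) → ℂ := fun m a => match m, a with
    | none, none => e
    | none, some _ => 0
    | some _, none => 0
    | some m, some i => e * conj (B m i)
  choose s hs0 hsd using fun m => hs (W m)
  have hsub : ball p (min r₁ r₂) ⊆ ball p r₁ := ball_subset_ball (min_le_left _ _)
  refine ⟨min r₁ r₂, lt_min hr₁ hr₂, hsub.trans hball, s, fun m x hx => hsd m x (hsub hx),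
    fun x hx => ?_, ?_, fun i => ?_, fun m => ?_, ?_⟩
  · refine sub_eq_zero.1 (huniq (min r₁ r₂) (min_le_right _ _) (fun a b x =>
      tractorForm φ c a b x - ∑ m, modelSign n c m * (s m a x * conj (s m b x))) ?_ ?_ x hx
        none none)
    · intro x hx a b
      have hxU := hball (hsub hx)
      have dN : ∀ a b, DifferentiableAt ℝ (tractorForm φ c a b) x := fun a b =>
        ((hφ.contDiffOn_tractorForm hU a b).contDiffAt (hU.mem_nhds hxU)).differentiableAt (by simp)
      have ds : ∀ m a, DifferentiableAt ℝ (s m a) x := fun m a => (hsd m x (hsub hx) a).1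
      have dss : ∀ m, DifferentiableAt ℝ (fun x => s m a x * conj (s m b x)) x := fun m =>
        (ds m a).mul (differentiableAt_conj (ds m b))
      have dsum : DifferentiableAt ℝ
          (fun x => ∑ m, modelSign n c m * (s m a x * conj (s m b x))) x :=
        DifferentiableAt.fun_sum fun m _ => (dss m).const_mul _
      refine ⟨(dN a b).sub dsum, fun d => ?_⟩
      rw [wirt_sub d (dN a b) dsum, hφ.wirt_tractorForm hU hxU,
        wirt_sum (F := fun m x => modelSign n c m * (s m a x * conj (s m b x))) _ _
          fun m _ => (dss m).const_mul _]
      have h1 : ∀ m, wirt d (fun x => modelSign n c m * (s m a x * conj (s m b x))) x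
          = ∑ k, tractor φ c d a k x * (modelSign n c m * (s m k x * conj (s m b x)))
            + ∑ k, conj (tractor φ c d.swap b k x)
              * (modelSign n c m * (s m a x * conj (s m k x))) := by
        intro m
        rw [wirt_const_mul d _ (dss m), wirt_mul d (ds m a) (differentiableAt_conj (ds m b)),
          wirt_conj d (ds m b), (hsd m x (hsub hx) a).2, (hsd m x (hsub hx) b).2, map_sum,
          Finset.sum_mul, Finset.mul_sum, mul_add, Finset.mul_sum, Finset.mul_sum]
        congr 1 <;> refine Finset.sum_congr rfl fun k _ => ?_
        · ring
        · rw [map_mul]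
          ring
      simp only [h1, mul_sub, Finset.sum_sub_distrib, Finset.sum_add_distrib, Finset.mul_sum]
      rw [Finset.sum_comm (f := fun m k => tractor φ c d a k x
          * (modelSign n c m * (s m k x * conj (s m b x)))),
        Finset.sum_comm (f := fun m k => conj (tractor φ c d.swap b k x)
          * (modelSign n c m * (s m a x * conj (s m k x))))]
      ring
    · intro a b
      simp only [hs0]
      rw [Fintype.sum_option]
      rcases a with _ | i <;> rcases b with _ | j <;>
        simp only [W, tractorForm, modelSign, map_zero, mul_zero, zero_mul, Finset.sum_const_zero,
          add_zero, zero_add, sub_zero, one_mul]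
      · rw [hee, sub_self]
      · have hg : metric φ p i j = ∑ m, conj (B m i) * B m j := by
          conv_lhs => rw [hB]
          rfl
        rw [hg, ← hee, Finset.mul_sum, Finset.mul_sum, sub_eq_zero]
        refine Finset.sum_congr rfl fun m _ => ?_
        simp
        ring
  · rw [hs0]
    exact he0
  · rw [hs0]
  · rw [hs0]
  · have : (Matrix.of fun m i => s (some m) (some i) p) = e • B.map conj := by
      ext m i
      simp [hs0, W]
    rw [this, Matrix.det_smul]
    refine mul_ne_zero (pow_ne_zero _ he0) ?_
    have h2 : (B.map conj).det = conj B.det := (RingHom.map_det (starRingEnd ℂ) B).symm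
    rw [h2]
    simpa using hBdet

/-- A holomorphic map whose Jacobian matrices `J` are continuous and invertible on an open set is a
local holomorphic coordinate system. -/
theorem exists_holomorphicCoordinates {V : Set (Cn n)} (hV : IsOpen V) {F : Cn n → Cn n}
    {J : Fin n → Fin n → Cn n → ℂ} (hJ : ∀ m k, ContinuousOn (J m k) V)
    (hdet : ∀ x ∈ V, (Matrix.of fun m k => J m k x).det ≠ 0)
    (hF : ∀ x ∈ V, HasFDerivAt F
      (Matrix.toEuclideanCLM (n := Fin n) (𝕜 := ℂ) (Matrix.of fun m k => J m k x)) x)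
    {p : Cn n} (hp : p ∈ V) :
    ∃ f : OpenPartialHomeomorph (Cn n) (Cn n), IsHolomorphicCoordinates f ∧ p ∈ f.source ∧
      f.source ⊆ V ∧ ⇑f = F := by
  have hequiv : ∀ x ∈ V, ∃ G : Cn n ≃L[ℂ] Cn n, (G : Cn n →L[ℂ] Cn n)
      = Matrix.toEuclideanCLM (n := Fin n) (𝕜 := ℂ) (Matrix.of fun m k => J m k x) := by
    intro x hx
    set M := Matrix.of fun m k => J m k x with hM
    have hu : IsUnit M.det := isUnit_iff_ne_zero.2 (hdet x hx)
    refine ⟨ContinuousLinearEquiv.equivOfInverse (Matrix.toEuclideanCLM (n := Fin n) (𝕜 := ℂ) M)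
      (Matrix.toEuclideanCLM (n := Fin n) (𝕜 := ℂ) M⁻¹) (fun v => ?_) (fun v => ?_), rfl⟩
    · rw [← mul_apply_eq_comp, ← map_mul, Matrix.nonsing_inv_mul _ hu, map_one]
      rfl
    · rw [← mul_apply_eq_comp, ← map_mul, Matrix.mul_nonsing_inv _ hu, map_one]
      rfl
  have hcont : ContinuousAt (fun x => Matrix.toEuclideanCLM (n := Fin n) (𝕜 := ℂ)
      (Matrix.of fun m k => J m k x)) p := by
    have h1 : ContinuousAt (fun x m k => J m k x) p := continuousAt_pi.2 fun m =>
      continuousAt_pi.2 fun k => (hJ m k).continuousAt (hV.mem_nhds hp)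
    exact ContinuousAt.comp (f := fun x m k => J m k x)
      (g := arrayToCLM (ι := Fin n)) arrayToCLM.continuous.continuousAt h1
  obtain ⟨G, hG⟩ := hequiv p hp
  -- Continuity of the Jacobian upgrades the derivative to a strict one, as the inverse function
  -- theorem requires.
  have hstrict : HasStrictFDerivAt F (G : Cn n →L[ℂ] Cn n) p := by
    rw [hG]
    exact hasStrictFDerivAt_of_hasFDerivAt_of_continuousAt (eventually_of_mem (hV.mem_nhds hp) hF)
      hcont
  set f := (hstrict.toOpenPartialHomeomorph F).restrOpen V hV with hf
  have hfV : f.source ⊆ V := inter_subset_right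
  refine ⟨f, ⟨fun x hx => ?_, fun y hy => ?_⟩, ⟨hstrict.mem_toOpenPartialHomeomorph_source, hp⟩,
    hfV, rfl⟩
  · exact (hF x (hfV hx)).differentiableAt.differentiableWithinAt
  · have hx := f.map_target hy
    obtain ⟨G', hG'⟩ := hequiv _ (hfV hx)
    have h2 := hF _ (hfV hx)
    rw [← hG'] at h2
    exact (f.hasFDerivAt_symm hy h2).differentiableAt.differentiableWithinAt

/-- Local uniformization: constant holomorphic sectional curvature `2c` gives `log (1 + c |f|²)` the same
complex Hessian as `c φ` in suitable holomorphic coordinates `f`. -/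
theorem IsKahlerPotentialOn.exists_coordinates (hφ : IsKahlerPotentialOn φ U)
    (hU : IsOpen U) (hκ : HasConstHolSectionalCurvatureOn φ (2 * c) U) {p : Cn n} (hp : p ∈ U) :
    ∃ f : OpenPartialHomeomorph (Cn n) (Cn n), IsHolomorphicCoordinates f ∧ p ∈ f.source ∧
      f.source ⊆ U ∧ (∀ w ∈ f.source, 0 < 1 + c * ‖f w‖ ^ 2) ∧
      ∀ w ∈ f.source, ∀ i j,
        metric (fun x => Real.log (1 + c * ‖f x‖ ^ 2)) w i j = c * metric φ w i j := by
  obtain ⟨r, hr, hball, s, hsd, hexp, hp0, hp1, hp2, hpdet⟩ :=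
    hφ.exists_normalized_sections hU hκ hp
  set h : Cn n → ℂ := s none none with hh
  have hcont : ∀ m a, ContinuousOn (s m a) (ball p r) := fun m a x hx =>
    (hsd m x hx a).1.continuousAt.continuousWithinAt
  set V₀ : Set (Cn n) := ball p r ∩ h ⁻¹' {0}ᶜ with hV₀
  have hV₀o : IsOpen V₀ :=
    (hcont none none).isOpen_inter_preimage isOpen_ball isClosed_singleton.isOpen_compl
  have hV₀h : ∀ {x}, x ∈ V₀ → h x ≠ 0 := fun hx => hx.2
  have dh : ∀ {x}, x ∈ V₀ → ∀ m a, DifferentiableAt ℝ (s m a) x := fun hx m a =>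
    (hsd m _ hx.1 a).1
  have wbar : ∀ {x}, x ∈ V₀ → ∀ m i, wirt (Sum.inr i) (s m none) x = 0 := fun hx m i => by
    rw [(hsd m _ hx.1 none).2]
    simp [tractor]
  have whol : ∀ {x}, x ∈ V₀ → ∀ m i, wirt (Sum.inl i) (s m none) x
      = c * wirt (Sum.inl i) (fun w => (φ w : ℂ)) x * s m none x + s m (some i) x :=
    fun hx m i => by
      rw [(hsd m _ hx.1 none).2, Fintype.sum_option]
      simp [tractor]
  have wbar' : ∀ {x}, x ∈ V₀ → ∀ m i j, wirt (Sum.inr j) (s m (some i)) x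
      = -c * metric φ x i j * s m none x := fun hx m i j => by
    rw [(hsd m _ hx.1 (some i)).2, Fintype.sum_option]
    simp [tractor]
  -- The Jacobian of the quotients `hₘ / h₀`. The terms `c φₖ h` in `∂ₖh` cancel in the quotient
  -- rule, so only the components `α` occur.
  set J : Fin n → Fin n → Cn n → ℂ := fun m k x =>
    (s (some m) (some k) x * h x - s (some m) none x * s none (some k) x) / h x ^ 2 with hJ
  have hJc : ∀ m k, ContinuousOn (J m k) V₀ := fun m k =>
    ((((hcont _ _).mul (hcont _ _)).sub ((hcont _ _).mul (hcont _ _))).mono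
      (fun _ hx => hx.1)).div (((hcont none none).mono (fun _ hx => hx.1)).pow 2)
      fun x hx => pow_ne_zero 2 (hV₀h hx)
  have hdetc : ContinuousOn (fun x => (Matrix.of fun m k => J m k x).det) V₀ := by
    simp only [Matrix.det_apply', Matrix.of_apply]
    exact continuousOn_finsetSum _ fun σ _ => continuousOn_const.mul
      (continuousOn_finsetProd _ fun i _ => hJc _ _)
  set V : Set (Cn n) := V₀ ∩ (fun x => (Matrix.of fun m k => J m k x).det) ⁻¹' {0}ᶜ with hV
  have hVo : IsOpen V := hdetc.isOpen_inter_preimage hV₀o isClosed_singleton.isOpen_compl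
  have hpV₀ : p ∈ V₀ := ⟨mem_ball_self hr, hp0⟩
  have hpV : p ∈ V := by
    refine ⟨hpV₀, ?_⟩
    have e : (Matrix.of fun m k => J m k p)
        = (h p)⁻¹ • Matrix.of fun m i => s (some m) (some i) p := by
      ext m k
      simp only [hJ, hp1, hp2, Matrix.of_apply, Matrix.smul_apply, smul_eq_mul]
      field_simp
      ring
    change (Matrix.of fun m k => J m k p).det ≠ 0
    rw [e, Matrix.det_smul]
    exact mul_ne_zero (pow_ne_zero _ (inv_ne_zero hp0)) hpdet
  set F : Cn n → Cn n := fun x => WithLp.toLp 2 fun m => s (some m) none x / h x with hF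
  have hFd : ∀ x ∈ V, HasFDerivAt F
      (Matrix.toEuclideanCLM (n := Fin n) (𝕜 := ℂ) (Matrix.of fun m k => J m k x)) x := by
    rintro x ⟨hx, -⟩
    refine (hasFDerivWithinAt_univ.1 (hasFDerivWithinAt_euclidean.2 fun m =>
      hasFDerivWithinAt_univ.2 ?_))
    have dq : DifferentiableAt ℝ (fun w => s (some m) none w / h w) x :=
      differentiableAt_div (dh hx _ _) (dh hx _ _) (hV₀h hx)
    have h1 := hasFDerivAt_of_dzbar_eq_zero dq fun i => by
      rw [wirt_div _ (dh hx _ _) (dh hx _ _) (hV₀h hx), wbar hx, wbar hx]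
      simp
    refine h1.congr_fderiv ?_
    ext v
    simp only [sum_apply, smul_apply, smul_eq_mul, ContinuousLinearMap.comp_apply,
      PiLp.proj_apply, Matrix.ofLp_toEuclideanCLM, Matrix.mulVec, dotProduct, Matrix.of_apply]
    refine Finset.sum_congr rfl fun k _ => ?_
    rw [wirt_div _ (dh hx _ _) (dh hx _ _) (hV₀h hx), whol hx, whol hx]
    simp only [hJ, hh]
    ring
  obtain ⟨f, hf, hpf, hfV, hfF⟩ := exists_holomorphicCoordinates hVo
    (fun m k => (hJc m k).mono inter_subset_left) (fun x hx => hx.2) hFd hpV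
  have hfV₀ : f.source ⊆ V₀ := hfV.trans inter_subset_left
  -- This is `e^{cφ} = |h₀|² + c ∑ |hₘ|²` divided by `|h₀|²`; positivity of `1 + c|F|²` is then
  -- immediate.
  have hmodel : ∀ x ∈ V₀, 1 + c * ‖F x‖ ^ 2 = Real.exp (c * φ x) / ‖h x‖ ^ 2 := by
    intro x hx
    have h1 := hexp x hx.1
    have h2 : Real.exp (c * φ x) = ‖h x‖ ^ 2 + c * ∑ m, ‖s (some m) none x‖ ^ 2 := by
      rw [Fintype.sum_option] at h1
      simp only [modelSign, Complex.mul_conj, Complex.normSq_eq_norm_sq, ← Finset.mul_sum] at h1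
      rw [one_mul] at h1
      exact_mod_cast h1
    have h3 : ‖h x‖ ≠ 0 := norm_ne_zero_iff.2 (hV₀h hx)
    rw [h2, EuclideanSpace.norm_sq_eq]
    simp only [hF, norm_div, div_pow, ← Finset.sum_div]
    field_simp
  have hpos : ∀ x ∈ V₀, 0 < 1 + c * ‖F x‖ ^ 2 := fun x hx => by
    rw [hmodel x hx]
    have h3 : 0 < ‖h x‖ := norm_pos_iff.2 (hV₀h hx)
    positivity
  refine ⟨f, hf, hpf, fun x hx => hball (hfV₀ hx).1, fun w hw => by
    rw [hfF]; exact hpos w (hfV₀ hw), fun w hw i j => ?_⟩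
  have hlog : ∀ x ∈ V₀, ((Real.log (1 + c * ‖f x‖ ^ 2) : ℝ) : ℂ)
      = c * φ x - ((Real.log (‖h x‖ ^ 2) : ℝ) : ℂ) := by
    intro x hx
    have h3 : ‖h x‖ ≠ 0 := norm_ne_zero_iff.2 (hV₀h hx)
    rw [hfF, hmodel x hx, Real.log_div (Real.exp_ne_zero _) (pow_ne_zero 2 h3), Real.log_exp]
    push_cast
    rfl
  -- Here `∂ⱼh₀ / h₀ = cφⱼ + αⱼ / h₀`, so the term with `φ` drops out. The remaining derivative of
  -- `αⱼ / h₀` is given by the system, where `∂_{ī} αⱼ = -c g_{j ī} h₀` produces the metric.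
  have hfirst : ∀ x ∈ V₀, wirt (Sum.inr j)
      (fun x => ((Real.log (1 + c * ‖f x‖ ^ 2) : ℝ) : ℂ)) x
      = -conj (s none (some j) x / h x) := by
    intro x hx
    have hxU := hball hx.1
    have dΦ : DifferentiableAt ℝ (fun w => (φ w : ℂ)) x :=
      (hφ.contDiffOn_ofReal.contDiffAt (hU.mem_nhds hxU)).differentiableAt (by simp)
    have h3 : ‖h x‖ ^ 2 ≠ 0 := pow_ne_zero 2 (norm_ne_zero_iff.2 (hV₀h hx))
    have dlog : DifferentiableAt ℝ (fun x => ((Real.log (‖h x‖ ^ 2) : ℝ) : ℂ)) x :=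
      Complex.ofRealCLM.differentiableAt.comp x (((dh hx none none).norm_sq ℝ).log h3)
    rw [wirt_congr_on hV₀o hlog hx, wirt_sub _ (dΦ.const_mul _) dlog, wirt_const_mul _ _ dΦ,
      hφ.wirt_inr_ofReal hU hxU, wirt_log_norm_sq _ (dh hx none none) (hV₀h hx),
      wbar hx, Sum.swap_inr, whol hx]
    have h4 := hV₀h hx
    have h5 : (c * wirt (Sum.inl j) (fun w => (φ w : ℂ)) x * s none none x + s none (some j) x)
        / h x = c * wirt (Sum.inl j) (fun w => (φ w : ℂ)) x + s none (some j) x / h x := by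
      rw [← hh]
      field_simp
    rw [h5, map_add, map_mul, Complex.conj_ofReal, zero_div]
    ring
  have hw₀ := hfV₀ hw
  have dq : DifferentiableAt ℝ (fun w => s none (some j) w / h w) w :=
    differentiableAt_div (dh hw₀ _ _) (dh hw₀ _ _) (hV₀h hw₀)
  have hm := congrFun (metric_eq (fun x => Real.log (1 + c * ‖f x‖ ^ 2)) i j) w
  rw [hm, wirt_congr_on hV₀o hfirst hw₀, wirt_neg, wirt_conj _ dq, Sum.swap_inl,
    wirt_div _ (dh hw₀ _ _) (dh hw₀ _ _) (hV₀h hw₀), wbar hw₀, wbar' hw₀]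
  have h4 := hV₀h hw₀
  have h5 : (-c * metric φ w j i * s none none w * h w - s none (some j) w * 0) / h w ^ 2
      = -c * metric φ w j i := by
    rw [← hh]
    field_simp
    ring
  rw [h5, map_mul, hφ.conj_metric (hball hw₀.1), map_neg, Complex.conj_ofReal]
  ring

theorem iddbar_eq_of_metric_eq {ψ : Cn n → ℝ} {w : Cn n} (hc : c * c = 1)
    (h : ∀ i j, metric ψ w i j = c * metric φ w i j) (u v : Cn n) :
    iddbar φ w u v = c * iddbar ψ w u v := by
  have hc' : (c : ℂ) * c = 1 := by exact_mod_cast hc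
  simp only [iddbar, h, Finset.mul_sum]
  refine Finset.sum_congr rfl fun i _ => Finset.sum_congr rfl fun j _ => ?_
  linear_combination (-Complex.I * (metric φ w i j * (u i * conj (v j) - v i * conj (u j)))) * hc'

end KahlerBall

end

theorem theorem1 (n : ℕ) (φ : KahlerBall.Cn n → ℝ)
    (hφ : KahlerBall.IsKahlerPotentialOn φ (Metric.ball 0 1)) :
    (KahlerBall.HasConstHolSectionalCurvatureOn φ 2 (Metric.ball 0 1) →
      ∀ p ∈ Metric.ball (0 : KahlerBall.Cn n) 1,
        ∃ f : OpenPartialHomeomorph (KahlerBall.Cn n) (KahlerBall.Cn n),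
          KahlerBall.IsHolomorphicCoordinates f ∧
          p ∈ f.source ∧ f.source ⊆ Metric.ball 0 1 ∧
          ∀ w ∈ f.source, ∀ u v : KahlerBall.Cn n,
            KahlerBall.iddbar φ w u v
              = KahlerBall.iddbar (fun x => Real.log (1 + ‖f x‖ ^ 2)) w u v) ∧
    (KahlerBall.HasConstHolSectionalCurvatureOn φ (-2) (Metric.ball 0 1) →
      ∀ p ∈ Metric.ball (0 : KahlerBall.Cn n) 1,
        ∃ f : OpenPartialHomeomorph (KahlerBall.Cn n) (KahlerBall.Cn n),
          KahlerBall.IsHolomorphicCoordinates f ∧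
          p ∈ f.source ∧ f.source ⊆ Metric.ball 0 1 ∧
          (∀ w ∈ f.source, ‖f w‖ < 1) ∧
          ∀ w ∈ f.source, ∀ u v : KahlerBall.Cn n,
            KahlerBall.iddbar φ w u v
              = -KahlerBall.iddbar (fun x => Real.log (1 - ‖f x‖ ^ 2)) w u v) := by
  refine ⟨fun hκ p hp => ?_, fun hκ p hp => ?_⟩
  · obtain ⟨f, hf, hpf, hfU, -, hfm⟩ := hφ.exists_coordinates (c := 1) Metric.isOpen_ball
      (by rwa [mul_one]) hp
    refine ⟨f, hf, hpf, hfU, fun w hw u v => ?_⟩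
    simpa using KahlerBall.iddbar_eq_of_metric_eq (one_mul 1) (hfm w hw) u v
  · obtain ⟨f, hf, hpf, hfU, hpos, hfm⟩ := hφ.exists_coordinates (c := -1) Metric.isOpen_ball
      (by rwa [mul_neg_one]) hp
    refine ⟨f, hf, hpf, hfU, fun w hw => ?_, fun w hw u v => ?_⟩
    · have := hpos w hw
      nlinarith [norm_nonneg (f w)]
    · simpa [← sub_eq_add_neg] using
        KahlerBall.iddbar_eq_of_metric_eq (by norm_num) (hfm w hw) u v
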